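/- \textbf{Marked graphs.} A marked graph $(G,M)$ is a finite 3-regular graph $G$ (parallel edges, self-loops and closed loops without vertices are allowed) together with finitely many marks placed on its edges, several marks per edge being allowed. A cut of $(G,M)$ is a partition of the set of vertices and marks into two sides $A,B$; its size is the number of pieces of edges, between consecutive vertices or marks, that join $A$ to $B$ (so one edge may be cut several times, between different marks). For $t\in\mathbb N$, $(G,M)$ is \emph{$t$-robust} if for every cut of size $f\le t$ at least one side contains at most $f$ marks. The vertex ratio of a marked graph with $v$ vertices and $n\ge 1$ marks is $v/n$; $r_t^n$ is the minimum vertex ratio over all $t$-robust marked graphs with $n$ marks ($+\infty$ if there is none), and $r_t=\liminf_{n\to\infty} r_t^n$ is the optimal vertex ratio. \textbf{Fault tolerance.} The $n$-qubit CAT state is $|0\rangle^{\otimes n}+|1\rangle^{\otimes n}$, up to a scalar, represented by the ZX-diagram with a single phase-free $Z$-spider with $n$ output legs. A fault $F$ on a ZX-diagram $D$ places a Pauli operator on every edge; its weight is the number of non-identity ones, $D^F$ is the resulting diagram, and $F$ is detectable if $D^F=0$. Two diagrams $D_1,D_2$ are $w$-fault-equivalent if for every undetectable fault $F_1$ on $D_1$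 of weight less than $w$ there is a fault $F_2$ on $D_2$ of at most the same weight with $D_1^{F_1}=D_2^{F_2}$ up to a nonzero scalar, and vice versa. A circuit of CNOT gates, preparations of $|0\rangle$ and $|+\rangle$, and $Z$- and $X$-basis measurements post-selected on outcome $0$ prepares the $n$-qubit CAT state $t$-fault-tolerantly ($t$-FT) if its associated ZX-diagram is $(t+1)$-fault-equivalent to the CAT state. Here each CNOT becomes a $Z$-spider (control) joined by an edge to an $X$-spider (target), and each preparation or measurement becomes a one-legged spider. Ancillae are the qubits of the circuit that are not among its $n$ outputs. \textbf{Theorem.} Let $(G,M)$ be a $t$-robust marked graph with $n\ge 1$ marks whose vertex ratio equals the optimal vertex ratio $r_t$. Then there is a circuit that $t$-FT prepares the $n$-qubit CAT state, using at most $\left(\frac{29r_t+26}{10}\right)n$ CNOT gates and at most $\left(\frac{12r_t+8}{5}\right)n$ ancillae, with CNOT depth $3$ if $n\ge 2$, and at most $3$ if $n=1$. -/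

import Mathlib

open scoped BigOperators ENNReal

/-! ### Marked 3-regular graphs, robustness and the optimal vertex ratio -/

/-- A finite 3-regular graph with marks on its edges. Parallel edges and self-loops are allowed
(a self-loop counts twice for the degree), and so are closed loops carrying no vertex. Every edge
has an arbitrary orientation, from `src` to `tgt`; an edge or a closed loop may carry any number of
marks. -/
structure MarkedGraph where
  numVertices : ℕ
  numEdges : ℕ
  numLoops : ℕ
  src : Fin numEdges → Fin numVertices
  tgt : Fin numEdges → Fin numVertices
  regular : ∀ v : Fin numVertices,
    (Finset.univ.filter (fun e => src e = v)).card +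
      (Finset.univ.filter (fun e => tgt e = v)).card = 3
  edgeMarks : Fin numEdges → ℕ
  loopMarks : Fin numLoops → ℕ

namespace MarkedGraph

/-- The marks; the marks of an edge are listed from its source to its target, those of a closed
loop in cyclic order. -/
abbrev Mark (G : MarkedGraph) : Type :=
  (Σ e : Fin G.numEdges, Fin (G.edgeMarks e)) ⊕ (Σ k : Fin G.numLoops, Fin (G.loopMarks k))

/-- The total number of marks. -/
def numMarks (G : MarkedGraph) : ℕ := ∑ e, G.edgeMarks e + ∑ k, G.loopMarks k

/-- Vertices and marks. -/
abbrev Node (G : MarkedGraph) : Type := Fin G.numVertices ⊕ G.Mark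

/-- The pieces into which the marks divide the edges and the closed loops: an edge with `m` marks
has `m + 1` segments, a closed loop with `m ≥ 1` marks has `m`. -/
abbrev Segment (G : MarkedGraph) : Type :=
  (Σ e : Fin G.numEdges, Fin (G.edgeMarks e + 1)) ⊕ (Σ k : Fin G.numLoops, Fin (G.loopMarks k))

/-- The node at which a segment starts. -/
def segStart (G : MarkedGraph) : G.Segment → G.Node
  | Sum.inl ⟨e, i⟩ =>
      Fin.cases (motive := fun _ => G.Node) (Sum.inl (G.src e))
        (fun j => Sum.inr (Sum.inl ⟨e, j⟩)) i
  | Sum.inr ⟨k, i⟩ => Sum.inr (Sum.inr ⟨k, i⟩)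

/-- The node at which a segment ends. -/
def segEnd (G : MarkedGraph) : G.Segment → G.Node
  | Sum.inl ⟨e, i⟩ =>
      Fin.lastCases (motive := fun _ => G.Node) (Sum.inl (G.tgt e))
        (fun j => Sum.inr (Sum.inl ⟨e, j⟩)) i
  | Sum.inr ⟨k, i⟩ => Sum.inr (Sum.inr ⟨k, finRotate (G.loopMarks k) i⟩)

/-- The number of places at which the graph is cut when the nodes in `A` are separated from the
other ones. One edge may be cut several times, between different marks. -/
def cutSize (G : MarkedGraph) (A : Finset G.Node) : ℕ :=
  (Finset.univ.filter (fun s : G.Segment => decide (G.segStart s ∈ A) ≠ decide (G.segEnd s ∈ A))).card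

/-- The number of marks on the side `A` of a cut. -/
def marksIn (G : MarkedGraph) (A : Finset G.Node) : ℕ :=
  (Finset.univ.filter (fun m : G.Mark => (Sum.inr m : G.Node) ∈ A)).card

/-- Every cut in `f ≤ t` places leaves at most `f` marks on one of its two sides. -/
def IsRobust (G : MarkedGraph) (t : ℕ) : Prop :=
  ∀ A : Finset G.Node, G.cutSize A ≤ t →
    G.marksIn A ≤ G.cutSize A ∨ G.marksIn Aᶜ ≤ G.cutSize A

/-- Number of vertices per mark. -/
noncomputable def vertexRatio (G : MarkedGraph) : ℝ≥0∞ := (G.numVertices : ℝ≥0∞) / (G.numMarks : ℝ≥0∞)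

end MarkedGraph

/-- The least vertex ratio of a `t`-robust marked graph with `n` marks (`⊤` if there is none). -/
noncomputable def minVertexRatio (t n : ℕ) : ℝ≥0∞ :=
  ⨅ (G : MarkedGraph) (_ : G.IsRobust t ∧ G.numMarks = n), G.vertexRatio

/-- The optimal vertex ratio at fault weight `t`. -/
noncomputable def optimalVertexRatio (t : ℕ) : ℝ≥0∞ :=
  Filter.liminf (fun n : ℕ => minVertexRatio t n) Filter.atTop

/-! ### Pauli ZX-diagrams without inputs, their interpretation and faults on their edges -/

/-- Two colours or two bases. -/
inductive ZXType where
  | Z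
  | X
  deriving DecidableEq

/-- The Pauli operators, up to phase. -/
inductive Pauli where
  | I
  | X
  | Y
  | Z
  deriving DecidableEq

/-- The matrix of a Pauli operator. -/
noncomputable def Pauli.toMatrix : Pauli → Matrix (Fin 2) (Fin 2) ℂ
  | .I => 1
  | .X => !![0, 1; 1, 0]
  | .Y => !![0, -Complex.I; Complex.I, 0]
  | .Z => !![1, 0; 0, -1]

/-- A Pauli ZX-diagram with no inputs and `n` outputs. The edge `e` has the two ends `(e, false)`
and `(e, true)`, and `attach` says to which spider or output an end belongs. The phase of the
spider `s` is `π` if `phase s` and `0` otherwise. Outputs have degree one. -/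
structure ZXDiagram (n : ℕ) where
  Spider : Type
  Edge : Type
  [fintypeSpider : Fintype Spider]
  [decidableEqSpider : DecidableEq Spider]
  [fintypeEdge : Fintype Edge]
  [decidableEqEdge : DecidableEq Edge]
  color : Spider → ZXType
  phase : Spider → Bool
  attach : Edge × Bool → Spider ⊕ Fin n
  output_degree : ∀ k : Fin n, ∃! h : Edge × Bool, attach h = Sum.inr k

attribute [instance] ZXDiagram.fintypeSpider ZXDiagram.decidableEqSpider
  ZXDiagram.fintypeEdge ZXDiagram.decidableEqEdge

namespace ZXDiagram

variable {n : ℕ}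

/-- The edge ends (legs) at a spider. -/
def legs (D : ZXDiagram n) (s : D.Spider) : Finset (D.Edge × Bool) :=
  Finset.univ.filter (fun h => D.attach h = Sum.inl s)

/-- The sign `e^(iα)` for the phase `α` of a spider. -/
noncomputable def sign (D : ZXDiagram n) (s : D.Spider) : ℂ := if D.phase s then -1 else 1

/-- The entry of the tensor of a spider at the bits `b` on its legs: the spider of colour `Z` and
phase `α` is `|0…0⟩ + e^(iα) |1…1⟩`, the one of colour `X` is `|+…+⟩ + e^(iα) |-…-⟩`. -/
noncomputable def spiderTensor (D : ZXDiagram n) (s : D.Spider) (b : D.Edge × Bool → Fin 2) : ℂ :=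
  match D.color s with
  | .Z => (if ∀ h ∈ D.legs s, b h = 0 then 1 else 0) +
      D.sign s * (if ∀ h ∈ D.legs s, b h = 1 then 1 else 0)
  | .X => (∏ _h ∈ D.legs s, ((Real.sqrt 2 : ℝ) : ℂ)⁻¹) +
      D.sign s * ∏ h ∈ D.legs s, (((Real.sqrt 2 : ℝ) : ℂ)⁻¹ * (-1) ^ (b h : ℕ))

/-- A fault places a Pauli operator on every edge. -/
abbrev Fault (D : ZXDiagram n) : Type := D.Edge → Pauli

/-- The number of edges with a non-identity Pauli operator. -/
def Fault.weight {D : ZXDiagram n} (F : D.Fault) : ℕ :=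
  (Finset.univ.filter (fun e => F e ≠ Pauli.I)).card

/-- The interpretation of the diagram with the fault `F` placed on it, as a vector of amplitudes
indexed by the bit strings on the outputs: contract the tensors of the spiders along the edges,
each edge carrying the matrix of its Pauli operator. -/
noncomputable def interp (D : ZXDiagram n) (F : D.Fault) : (Fin n → Fin 2) → ℂ := fun x =>
  ∑ b : D.Edge × Bool → Fin 2,
    (∏ e, (F e).toMatrix (b (e, true)) (b (e, false))) *
    (∏ s, D.spiderTensor s b) *
    (if ∀ h k, D.attach h = Sum.inr k → b h = x k then 1 else 0)

/-- A fault is detectable if it makes the diagram zero. -/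
def Fault.Detectable {D : ZXDiagram n} (F : D.Fault) : Prop := D.interp F = 0

/-- Equality up to a nonzero scalar. -/
def ScalarEq (ψ φ : (Fin n → Fin 2) → ℂ) : Prop := ∃ c : ℂ, c ≠ 0 ∧ ψ = c • φ

/-- Every undetectable fault on `D₁` of weight less than `w` has an equivalent fault of at most
the same weight on `D₂`. -/
def FaultBounded (w : ℕ) (D₁ D₂ : ZXDiagram n) : Prop :=
  ∀ F₁ : D₁.Fault, ¬F₁.Detectable → F₁.weight < w →
    ∃ F₂ : D₂.Fault, F₂.weight ≤ F₁.weight ∧ ScalarEq (D₁.interp F₁) (D₂.interp F₂)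

/-- `w`-fault equivalence. -/
def FaultEquivalent (w : ℕ) (D₁ D₂ : ZXDiagram n) : Prop :=
  FaultBounded w D₁ D₂ ∧ FaultBounded w D₂ D₁

/-- The CAT state on `n` qubits: a single phase-free `Z`-spider with `n` output legs. -/
def cat (n : ℕ) : ZXDiagram n where
  Spider := Unit
  Edge := Fin n
  color := fun _ => .Z
  phase := fun _ => false
  attach := fun h => if h.2 then Sum.inr h.1 else Sum.inl ()
  output_degree := by
    intro k
    refine ⟨(k, true), by simp, ?_⟩
    rintro ⟨j, c⟩ h
    cases c <;> simp_all

/-- `D` prepares the CAT state `t`-fault-tolerantly: it is `(t + 1)`-fault-equivalent to it. -/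
def FTPreparesCat (t : ℕ) (D : ZXDiagram n) : Prop := FaultEquivalent (t + 1) D (cat n)

end ZXDiagram

/-! ### CNOT circuits -/

/-- A CNOT circuit for a state on `n` qubits. It has `n` output qubits `Sum.inl k` and
`numAncillae` further qubits `Sum.inr j`. Every qubit is prepared once, in `|0⟩` (`prep = Z`) or in
`|+⟩` (`prep = X`); the gates are listed in temporal order as pairs (control, target); every
ancilla is measured at the end in the basis `meas`, post-selected on the outcome `0`. -/
structure CNOTCircuit (n : ℕ) where
  numAncillae : ℕ
  prep : Fin n ⊕ Fin numAncillae → ZXType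
  gates : List ((Fin n ⊕ Fin numAncillae) × (Fin n ⊕ Fin numAncillae))
  control_ne_target : ∀ g ∈ gates, g.1 ≠ g.2
  meas : Fin numAncillae → ZXType

namespace CNOTCircuit

variable {n : ℕ}

/-- The qubits of the circuit. -/
abbrev Qubit (C : CNOTCircuit n) : Type := Fin n ⊕ Fin C.numAncillae

/-- The number of CNOT gates. -/
def cnotCount (C : CNOTCircuit n) : ℕ := C.gates.length

/-- The CNOT depth reached on every qubit after a list of gates: every CNOT is executed one time
step after the last earlier gate on either of its qubits. -/
def depthOn {W : Type} [DecidableEq W] (gs : List (W × W)) : W → ℕ :=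
  gs.foldl (fun d g w => if w = g.1 ∨ w = g.2 then max (d g.1) (d g.2) + 1 else d w) (fun _ => 0)

/-- The CNOT depth: the number of time steps needed for the CNOT gates. -/
def cnotDepth (C : CNOTCircuit n) : ℕ := Finset.univ.sup (depthOn C.gates)

/-- The index of a gate. -/
abbrev GateIdx (C : CNOTCircuit n) : Type := Fin C.gates.length

/-- Spiders of the associated diagram: one for the preparation of each qubit, two for each CNOT
gate (`(i, false)` on the control, `(i, true)` on the target), one for each measurement. -/
abbrev Spider (C : CNOTCircuit n) : Type := C.Qubit ⊕ (C.GateIdx × Bool) ⊕ Fin C.numAncillae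

/-- Edges of the associated diagram: for each qubit the wire arriving at the end of its line, for
each spider of a CNOT gate the wire arriving there from the past on its qubit, and for each CNOT
gate the edge joining its two spiders. -/
abbrev Edge (C : CNOTCircuit n) : Type := C.Qubit ⊕ (C.GateIdx × Bool) ⊕ C.GateIdx

/-- The qubit on which a spider of a CNOT gate lies. -/
def gateQubit (C : CNOTCircuit n) (p : C.GateIdx × Bool) : C.Qubit :=
  if p.2 then (C.gates.get p.1).2 else (C.gates.get p.1).1

/-- The end of the line of a qubit: an output or a measurement. -/
def lineEnd (C : CNOTCircuit n) : C.Qubit → C.Spider ⊕ Fin n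
  | Sum.inl k => Sum.inr k
  | Sum.inr j => Sum.inl (Sum.inr (Sum.inr j))

/-- The last spider on the qubit `w` before time `i`: that of the last gate on `w` among the gates
with index less than `i`, or the preparation if there is none. -/
def lastOn (C : CNOTCircuit n) (w : C.Qubit) (i : ℕ) : C.Spider :=
  match (List.finRange C.gates.length).reverse.find?
      (fun j : C.GateIdx =>
        decide ((j : ℕ) < i ∧ (C.gateQubit (j, false) = w ∨ C.gateQubit (j, true) = w))) with
  | some j => Sum.inr (Sum.inl (j, decide (C.gateQubit (j, true) = w)))
  | none => Sum.inl w

/-- The two ends of the edges of the associated diagram. -/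
def attach (C : CNOTCircuit n) : C.Edge × Bool → C.Spider ⊕ Fin n
  | (Sum.inl w, false) => Sum.inl (C.lastOn w C.gates.length)
  | (Sum.inl w, true) => C.lineEnd w
  | (Sum.inr (Sum.inl p), false) => Sum.inl (C.lastOn (C.gateQubit p) p.1)
  | (Sum.inr (Sum.inl p), true) => Sum.inl (Sum.inr (Sum.inl p))
  | (Sum.inr (Sum.inr i), c) => Sum.inl (Sum.inr (Sum.inl (i, c)))

/-- The colours of the spiders: `|0⟩`, `⟨0|` and the targets of CNOT gates are of colour `X`;
`|+⟩`, `⟨+|` and the controls are of colour `Z`. -/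
def spiderColor (C : CNOTCircuit n) : C.Spider → ZXType
  | Sum.inl w => match C.prep w with
    | .Z => .X
    | .X => .Z
  | Sum.inr (Sum.inl (_, c)) => if c then .X else .Z
  | Sum.inr (Sum.inr j) => match C.meas j with
    | .Z => .X
    | .X => .Z

/-- The phase-free ZX-diagram of the circuit, post-selected on the outcome `0` of every
measurement. -/
def associatedDiagram (C : CNOTCircuit n) : ZXDiagram n where
  Spider := C.Spider
  Edge := C.Edge
  color := C.spiderColor
  phase := fun _ => false
  attach := C.attach
  output_degree := by
    intro k
    refine ⟨(Sum.inl (Sum.inl k), true), rfl, ?_⟩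
    rintro ⟨(w | p | i), c⟩ h
    · rcases w with w | w <;> cases c <;> simp_all [attach, lineEnd]
    · cases c <;> simp [attach] at h
    · simp [attach] at h

end CNOTCircuit

/-! ### Pauli operators and signs as bits -/

/-! The circuit measures parities along the segments of the graph. Every vertex and every mark
becomes a qubit, normally prepared in `|+⟩`. A segment becomes an ancilla in `|0⟩` that is the
target of one CNOT from each of its two ends and is post-selected on `0`, which forces equal bits at
these ends. Vertex qubits are post-selected on `⟨+|` and marks are the outputs. A cut of size zero
has no marks on one of its sides, so the surviving bit strings are constant on the marks and the
state is a CAT state. To save resources, a set `S` of disjoint segments between distinct vertices is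
made direct: the far end starts in `|0⟩` and a single CNOT copies the bit to it, with no ancilla for
the segment.

Fault tolerance. By `interp_eq` the amplitudes of a phase-free diagram with Paulis on its edges are
signed counts of solutions of linear equations over `ZMod 2`. The `Z` parts of an undetectable fault
only produce a relative sign, which one `Z` on an output reproduces, so only bit flips matter
(`IsCatLike.ftPreparesCat`). For these, each node gets a reference bit: the bit after the middle one
of its three gates for a vertex, the final bit for a mark. Each flipped edge of the diagram can then
be blamed for at most one segment whose ends disagree or one output that deviates from its mark
(`Pays.unique`, `exists_node_bits`). Hence the cut defined by the reference bits, together with the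
deviating outputs, has size at most the number of flips. Robustness bounds the marks on one side of
that cut, and so the output flips up to complementation (`exists_flips`).

Depth. The CNOTs are the ports of the graph, the two ports of a direct segment sharing one, and are
put in three layers without conflicts. Hall's theorem and the direct segments supply the first
layer, and the remaining ports, at most two at each node and at each segment, are two-coloured
(`IsCubic.exists_schedule`).

Counting. With `v` vertices and `n` marks there are `3v/2 + n` segments, so `3v + 2n - |S|` CNOTs
and `5v/2 + n - |S|` ancillae. A maximum matching of vertex-to-vertex segments has `10|S| ≥ v - 2n`.
Optimality of the ratio is used only to write `v` as `r_t n`. -/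

/-- The sign `(-1)^a` of a bit. -/
noncomputable def bitSign (a : ZMod 2) : ℂ := if a = 0 then 1 else -1

theorem bitSign_zero : bitSign 0 = 1 := by simp [bitSign]

theorem bitSign_one : bitSign 1 = -1 := by simp [bitSign]

theorem zmod_two_cases (a : ZMod 2) : a = 0 ∨ a = 1 := by
  revert a; decide

theorem zmod_two_add_self (a : ZMod 2) : a + a = 0 := by
  revert a; decide

theorem zmod_two_eq_add_iff (a b c : ZMod 2) : a = b + c ↔ b = a + c := by
  revert a b c; decide

theorem bitSign_add (a b : ZMod 2) : bitSign (a + b) = bitSign a * bitSign b := by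
  rcases zmod_two_cases a with rfl | rfl <;> rcases zmod_two_cases b with rfl | rfl <;>
    simp [bitSign_zero, bitSign_one, zmod_two_add_self]

theorem bitSign_ne_zero (a : ZMod 2) : bitSign a ≠ 0 := by
  rcases zmod_two_cases a with rfl | rfl <;> simp [bitSign_zero, bitSign_one]

theorem bitSign_mul_self (a : ZMod 2) : bitSign a * bitSign a = 1 := by
  rw [← bitSign_add, zmod_two_add_self, bitSign_zero]

theorem bitSign_sum {ι : Type*} (s : Finset ι) (f : ι → ZMod 2) :
    bitSign (∑ i ∈ s, f i) = ∏ i ∈ s, bitSign (f i) := by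
  classical
  induction s using Finset.induction_on with
  | empty => simp [bitSign_zero]
  | insert a s ha ih => rw [Finset.sum_insert ha, Finset.prod_insert ha, bitSign_add, ih]

namespace Pauli

/-- Whether a Pauli operator flips bits. -/
def xBit : Pauli → ZMod 2
  | .I => 0
  | .X => 1
  | .Y => 1
  | .Z => 0

/-- Whether a Pauli operator changes signs. -/
def zBit : Pauli → ZMod 2
  | .I => 0
  | .X => 0
  | .Y => 1
  | .Z => 1

/-- The phase of a Pauli operator relative to a product of `X` and `Z`. -/
noncomputable def scal : Pauli → ℂ
  | .Y => Complex.I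
  | _ => 1

/-- The Pauli operator with given bits. -/
def ofBits (x z : ZMod 2) : Pauli :=
  if x = 0 then (if z = 0 then .I else .Z) else (if z = 0 then .X else .Y)

theorem xBit_ofBits (x z : ZMod 2) : (ofBits x z).xBit = x := by
  revert x z; decide

theorem zBit_ofBits (x z : ZMod 2) : (ofBits x z).zBit = z := by
  revert x z; decide

theorem ofBits_eq_I (x z : ZMod 2) : ofBits x z = .I ↔ x = 0 ∧ z = 0 := by
  revert x z; decide

theorem scal_ne_zero (P : Pauli) : P.scal ≠ 0 := by
  cases P <;> simp [scal]

theorem ne_I_of_xBit {P : Pauli} (h : P.xBit ≠ 0) : P ≠ .I := by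
  rintro rfl; exact h rfl

/-- Up to a scalar, a Pauli is `X` to the power `xBit` after `Z` to the power `zBit`. An edge thus
contributes one affine constraint on its end bits and one sign that is a character of the bit at its
`false` end. -/
theorem toMatrix_eq (P : Pauli) (i j : ZMod 2) :
    P.toMatrix i j = P.scal * if i = j + P.xBit then bitSign (P.zBit * j) else 0 := by
  have h01 : (0 : ZMod 2) ≠ 1 := by decide
  have e0 : ∀ i j : ZMod 2, (1 : Matrix (Fin 2) (Fin 2) ℂ) i j = if i = j then 1 else 0 :=
    fun i j => Matrix.one_apply
  rcases zmod_two_cases i with rfl | rfl <;> rcases zmod_two_cases j with rfl | rfl <;>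
    cases P <;>
    simp [toMatrix, scal, xBit, zBit, bitSign, zmod_two_add_self, e0, h01] <;> rfl

end Pauli

/-! ### Diagrams as sums over solutions of parity equations -/

namespace ZXDiagram

variable {n : ℕ}

/-- The bits `b` on the legs of a phase-free spider are equal (colour `Z`) or sum to zero
(colour `X`). -/
def SpiderOK (D : ZXDiagram n) (b : D.Edge × Bool → ZMod 2) (s : D.Spider) : Prop :=
  (D.color s = .Z → ∀ h ∈ D.legs s, ∀ h' ∈ D.legs s, b h = b h') ∧
    (D.color s = .X → ∑ h ∈ D.legs s, b h = 0)

/-- The bits `b` contribute to the amplitude of `x` when the bit flips `p` act on the edges. -/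
def IsSol (D : ZXDiagram n) (p : D.Edge → ZMod 2) (x : Fin n → ZMod 2)
    (b : D.Edge × Bool → ZMod 2) : Prop :=
  (∀ e, b (e, true) = b (e, false) + p e) ∧ (∀ s, D.SpiderOK b s) ∧
    ∀ h k, D.attach h = Sum.inr k → b h = x k

theorem SpiderOK.add {D : ZXDiagram n} {b b' : D.Edge × Bool → ZMod 2} {s : D.Spider}
    (h : D.SpiderOK b s) (h' : D.SpiderOK b' s) : D.SpiderOK (b + b') s := by
  refine ⟨fun hc l hl l' hl' => ?_, fun hc => ?_⟩
  · simp only [Pi.add_apply, h.1 hc l hl l' hl', h'.1 hc l hl l' hl']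
  · simp only [Pi.add_apply, Finset.sum_add_distrib, h.2 hc, h'.2 hc, add_zero]

theorem IsSol.add {D : ZXDiagram n} {p p' : D.Edge → ZMod 2} {x x' : Fin n → ZMod 2}
    {b b' : D.Edge × Bool → ZMod 2} (h : D.IsSol p x b) (h' : D.IsSol p' x' b') :
    D.IsSol (p + p') (x + x') (b + b') := by
  refine ⟨fun e => ?_, fun s => (h.2.1 s).add (h'.2.1 s), fun l k hl => ?_⟩
  · simp only [Pi.add_apply, h.1 e, h'.1 e]; ring
  · simp only [Pi.add_apply, h.2.2 l k hl, h'.2.2 l k hl]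

theorem add_self_bits {ι : Type*} (f : ι → ZMod 2) : f + f = 0 :=
  funext fun i => zmod_two_add_self (f i)

/-- In the computational basis a phase-free `Z`-spider requires equal bits, and for an `X`-spider
the terms `|+…+⟩` and `|-…-⟩` cancel on odd parity and add up on even parity. -/
theorem spiderTensor_eq (D : ZXDiagram n) (s : D.Spider) (hs : D.phase s = false) :
    ∃ κ : ℂ, κ ≠ 0 ∧ ∀ b : D.Edge × Bool → ZMod 2, ∀ [Decidable (D.SpiderOK b s)],
      D.spiderTensor s b = κ * if D.SpiderOK b s then 1 else 0 := by
  have h01 : (0 : ZMod 2) ≠ 1 := by decide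
  cases hc : D.color s with
  | Z =>
    rcases (D.legs s).eq_empty_or_nonempty with hl | ⟨l, hl⟩
    -- Without legs both the all-zeros and the all-ones term are present, so the scalar is `2`
    -- instead of `1`.
    · refine ⟨2, by norm_num, fun b _ => ?_⟩
      have : D.SpiderOK b s := ⟨fun _ => by simp [hl], fun _ => by simp [hl]⟩
      rw [if_pos this]
      simp [spiderTensor, hc, hl, sign, hs]; norm_num
    · refine ⟨1, one_ne_zero, fun b _ => ?_⟩
      have key : D.spiderTensor s b = (if ∀ h ∈ D.legs s, b h = 0 then 1 else 0) +
          (if ∀ h ∈ D.legs s, b h = 1 then 1 else 0) := by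
        simp only [spiderTensor, hc, sign, hs, Bool.false_eq_true, if_false, one_mul]
        rfl
      rw [key, one_mul]
      by_cases hok : D.SpiderOK b s
      · rw [if_pos hok]
        have h := hok.1 hc
        rcases zmod_two_cases (b l) with h0 | h0
        · rw [if_pos fun h' hh' => (h h' hh' l hl).trans h0, if_neg, add_zero]
          intro h1; exact h01 (h0.symm.trans (h1 l hl))
        · rw [if_neg, if_pos fun h' hh' => (h h' hh' l hl).trans h0, zero_add]
          intro h1; exact h01 ((h1 l hl).symm.trans h0)
      · rw [if_neg hok, if_neg, if_neg, add_zero]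
        · exact fun h => hok ⟨fun _ a ha a' ha' => (h a ha).trans (h a' ha').symm, by simp [hc]⟩
        · exact fun h => hok ⟨fun _ a ha a' ha' => (h a ha).trans (h a' ha').symm, by simp [hc]⟩
  | X =>
    refine ⟨2 * ∏ _h ∈ D.legs s, ((Real.sqrt 2 : ℝ) : ℂ)⁻¹, ?_, fun b _ => ?_⟩
    · simp
    · have hpow : ∀ a : ZMod 2, (-1 : ℂ) ^ (Fin.val (n := 2) a) = bitSign a := by
        intro a
        rcases zmod_two_cases a with rfl | rfl
        · exact (pow_zero _).trans bitSign_zero.symm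
        · exact (pow_one _).trans bitSign_one.symm
      have key : D.spiderTensor s b = (∏ _h ∈ D.legs s, ((Real.sqrt 2 : ℝ) : ℂ)⁻¹) +
          (∏ _h ∈ D.legs s, ((Real.sqrt 2 : ℝ) : ℂ)⁻¹) * bitSign (∑ h ∈ D.legs s, b h) := by
        simp only [spiderTensor, hc, sign, hs, Bool.false_eq_true, if_false, one_mul]
        rw [bitSign_sum, Finset.prod_mul_distrib]
        simp only [← hpow]
      rw [key]
      by_cases hok : D.SpiderOK b s
      · rw [if_pos hok, hok.2 hc, bitSign_zero]; ring
      · rw [if_neg hok]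
        rcases zmod_two_cases (∑ h ∈ D.legs s, b h) with h0 | h0
        · exact absurd ⟨by simp [hc], fun _ => h0⟩ hok
        · rw [h0, bitSign_one]; ring

theorem ite_mul_ite_mul_ite {A B C E : Prop} {_ : Decidable A} {_ : Decidable B} {_ : Decidable C}
    {_ : Decidable E} (h : E ↔ A ∧ B ∧ C) (u v r : ℂ) :
    (u * if A then r else 0) * (v * if B then 1 else 0) * (if C then 1 else 0) =
      u * v * if E then r else 0 := by
  by_cases ha : A <;> by_cases hb : B <;> by_cases hc : C <;> simp [h, ha, hb, hc]; ring

/-- The amplitudes of a phase-free diagram are signed counts of solutions. -/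
theorem interp_eq (D : ZXDiagram n) (hD : ∀ s, D.phase s = false) (F : D.Fault) :
    ∃ K : ℂ, K ≠ 0 ∧ ∀ (x : Fin n → ZMod 2) [DecidablePred (D.IsSol (fun e => (F e).xBit) x)],
      D.interp F x = K * ∑ b with D.IsSol (fun e => (F e).xBit) x b,
        bitSign (∑ e, (F e).zBit * b (e, false)) := by
  classical
  choose κ hκ0 hκ using fun s => D.spiderTensor_eq s (hD s)
  refine ⟨(∏ e, (F e).scal) * ∏ s, κ s,
    mul_ne_zero (Finset.prod_ne_zero_iff.2 fun e _ => (F e).scal_ne_zero)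
      (Finset.prod_ne_zero_iff.2 fun s _ => hκ0 s), fun x _ => ?_⟩
  rw [Finset.sum_filter, Finset.mul_sum]
  refine Finset.sum_congr rfl fun b _ => ?_
  change D.Edge × Bool → ZMod 2 at b
  have h1 : (∏ e, (F e).toMatrix (b (e, true)) (b (e, false))) = (∏ e, (F e).scal) *
      if ∀ e, b (e, true) = b (e, false) + (F e).xBit then
        bitSign (∑ e, (F e).zBit * b (e, false)) else 0 := by
    simp only [Pauli.toMatrix_eq]
    rw [Finset.prod_mul_distrib, bitSign_sum, Finset.prod_ite_zero]
    simp
  have h2 : (∏ s, D.spiderTensor s b) = (∏ s, κ s) *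
      if ∀ s, D.SpiderOK b s then 1 else 0 := by
    simp only [hκ]
    rw [Finset.prod_mul_distrib, Finset.prod_ite_zero]
    simp
  rw [h1, h2]
  exact ite_mul_ite_mul_ite Iff.rfl _ _ _

end ZXDiagram

namespace Pauli

theorem ofBits_bits (P : Pauli) : ofBits P.xBit P.zBit = P := by
  cases P <;> rfl

end Pauli

/-! ### Diagrams of CAT states and their faults -/

namespace ZXDiagram

variable {n : ℕ}

/-- A phase-free diagram with a separate edge at each output whose unflipped solutions are constant
on the outputs and take both values there: it represents the CAT state. -/
structure IsCatLike (D : ZXDiagram n) (out : Fin n → D.Edge) : Prop where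
  phase_eq : ∀ s, D.phase s = false
  out_injective : Function.Injective out
  attach_out : ∀ k, D.attach (out k, true) = Sum.inr k
  exists_ones : ∃ b, D.IsSol 0 1 b
  const : ∀ x b, D.IsSol 0 x b → x = 0 ∨ x = 1

/-- The amplitudes, up to a scalar, of a CAT state with bit flips `d` and relative sign `a`. -/
noncomputable def catAmplitude (d : Fin n → ZMod 2) (a : ZMod 2) (x : Fin n → ZMod 2) : ℂ :=
  if x = d then 1 else if x = d + 1 then bitSign a else 0

theorem zero_ne_ones (hn : 0 < n) : (0 : Fin n → ZMod 2) ≠ 1 := fun h =>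
  absurd (congrFun h ⟨0, hn⟩) (show (0 : ZMod 2) ≠ 1 by decide)

/-- The fault with bits `p`, `q` on the output edges and nothing elsewhere. -/
noncomputable def outFault (D : ZXDiagram n) (out : Fin n → D.Edge) (p q : Fin n → ZMod 2) :
    D.Fault := Function.extend out (fun k => Pauli.ofBits (p k) (q k)) fun _ => .I

namespace IsCatLike

variable {D : ZXDiagram n} {out : Fin n → D.Edge}

theorem eq_out (hD : D.IsCatLike out) {h : D.Edge × Bool} {k : Fin n}
    (hk : D.attach h = Sum.inr k) : h = (out k, true) :=
  (D.output_degree k).unique hk (hD.attach_out k)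

theorem outFault_out (hD : D.IsCatLike out) (p q : Fin n → ZMod 2) (k : Fin n) :
    D.outFault out p q (out k) = Pauli.ofBits (p k) (q k) :=
  hD.out_injective.extend_apply _ _ k

theorem outFault_other {p q : Fin n → ZMod 2} {e : D.Edge} (he : ¬∃ k, out k = e) :
    D.outFault out p q e = .I :=
  Function.extend_apply' _ _ _ he

theorem weight_outFault (hD : D.IsCatLike out) (p q : Fin n → ZMod 2) :
    Fault.weight (D.outFault out p q) = (Finset.univ.filter fun k => p k ≠ 0 ∨ q k ≠ 0).card := by
  classical
  rw [Fault.weight, ← Finset.card_image_of_injective _ hD.out_injective]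
  congr 1
  ext e
  simp only [Finset.mem_filter, Finset.mem_univ, true_and, Finset.mem_image]
  by_cases he : ∃ k, out k = e
  · obtain ⟨k, rfl⟩ := he
    rw [hD.outFault_out, Ne, Pauli.ofBits_eq_I]
    constructor
    · exact fun h => ⟨k, by tauto, rfl⟩
    · rintro ⟨k', h, hk⟩
      rw [← hD.out_injective hk]; tauto
  · rw [outFault_other he]
    refine ⟨fun h => absurd rfl h, ?_⟩
    rintro ⟨k, -, hk⟩
    exact absurd ⟨k, hk⟩ he

/-- The flips caused by `outFault` at the output ends. -/
theorem isSol_outFault_shift (hD : D.IsCatLike out) (p q x : Fin n → ZMod 2) :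
    D.IsSol (fun e => (D.outFault out p q e).xBit) (x + p)
      (fun h => if h.2 then (D.outFault out p q h.1).xBit else 0) ↔ x = 0 := by
  constructor
  · intro h
    funext k
    have := h.2.2 _ k (hD.attach_out k)
    simp only [if_true, hD.outFault_out, Pauli.xBit_ofBits, Pi.add_apply] at this
    exact (left_eq_add.1 ((this.trans (add_comm _ _))))
  · rintro rfl
    refine ⟨fun e => by simp, fun s => ?_, ?_⟩
    · have h0 : ∀ h ∈ D.legs s,
          (if h.2 then (D.outFault out p q h.1).xBit else 0) = (0 : ZMod 2) := by
        rintro ⟨e, c⟩ hh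
        cases c
        · rfl
        · have : ¬∃ k, out k = e := by
            rintro ⟨k, rfl⟩
            simp [legs, hD.attach_out] at hh
          simp only [if_true, outFault_other this]; rfl
      refine ⟨fun _ h hh h' hh' => ?_, fun _ => Finset.sum_eq_zero h0⟩
      exact (h0 h hh).trans (h0 h' hh').symm
    · intro h k hk
      rw [hD.eq_out hk]
      simp [hD.outFault_out, Pauli.xBit_ofBits]

theorem bits_add_add (n : ℕ) (x p : Fin n → ZMod 2) : x + p + p = x := by
  rw [add_assoc, add_self_bits, add_zero]

/-- Translation by the flips at the output ends turns solutions into unflipped ones, so only `p` and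
`p + 1` occur as outputs. Adding the all-ones solution shows that both have equally many solutions,
and the sign depends only on the output bits: it is trivial at `p` and given by `∑ k, q k` at `p +
1`. -/
theorem interp_outFault (hD : D.IsCatLike out) (p q : Fin n → ZMod 2) :
    ∃ K : ℂ, K ≠ 0 ∧ D.interp (D.outFault out p q) = K • catAmplitude p (∑ k, q k) := by
  classical
  obtain ⟨K, hK, hint⟩ := D.interp_eq hD.phase_eq (D.outFault out p q)
  set P : D.Edge → ZMod 2 := fun e => (D.outFault out p q e).xBit with hP
  have hshift := (hD.isSol_outFault_shift p q 0).2 rfl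
  rw [zero_add] at hshift
  set δ : D.Edge × Bool → ZMod 2 := fun h => if h.2 then (D.outFault out p q h.1).xBit else 0
  have hsol : ∀ x b, D.IsSol P x b → D.IsSol 0 (x + p) (b + δ) := by
    intro x b hb
    have := hb.add hshift
    rwa [add_self_bits] at this
  have hsol' : ∀ x b, D.IsSol 0 (x + p) b → D.IsSol P x (b + δ) := by
    intro x b hb
    have := hb.add hshift
    rwa [zero_add, bits_add_add] at this
  have hchar : ∀ x b, D.IsSol P x b → ∑ e, (D.outFault out p q e).zBit * b (e, false) =
      ∑ k, q k * (x k + p k) := by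
    intro x b hb
    rw [← Finset.sum_subset (Finset.subset_univ (Finset.univ.image out)),
      Finset.sum_image hD.out_injective.injOn]
    · refine Finset.sum_congr rfl fun k _ => ?_
      rw [hD.outFault_out, Pauli.zBit_ofBits]
      have h1 := hb.1 (out k)
      rw [hb.2.2 _ k (hD.attach_out k)] at h1
      simp only [hP, hD.outFault_out, Pauli.xBit_ofBits] at h1
      rw [(zmod_two_eq_add_iff _ _ _).1 h1]
    · intro e _ he
      have : ¬∃ k, out k = e := by simpa using he
      rw [outFault_other this]
      simp [Pauli.zBit]
  obtain ⟨b1, hb1⟩ := hD.exists_ones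
  set N : ℕ := (Finset.univ.filter fun b => D.IsSol P p b).card with hN
  have hNpos : N ≠ 0 := by
    refine Finset.card_ne_zero.2 ⟨δ, ?_⟩
    simpa using hshift
  have hcard : (Finset.univ.filter fun b => D.IsSol P (p + 1) b).card = N := by
    refine Finset.card_bij' (fun b _ => b + b1) (fun b _ => b + b1) ?_ ?_ ?_ ?_
    · intro b hb
      simp only [Finset.mem_filter, Finset.mem_univ, true_and] at hb ⊢
      have := hb.add hb1
      rwa [add_zero, bits_add_add] at this
    · intro b hb
      simp only [Finset.mem_filter, Finset.mem_univ, true_and] at hb ⊢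
      have := hb.add hb1
      rwa [add_zero] at this
    · intro b _
      rw [add_assoc, add_self_bits, add_zero]
    · intro b _
      rw [add_assoc, add_self_bits, add_zero]
  refine ⟨K * N, mul_ne_zero hK (Nat.cast_ne_zero.2 hNpos), ?_⟩
  funext x
  change Fin n → ZMod 2 at x
  rw [hint x, Finset.sum_congr rfl (g := fun _ => bitSign (∑ k, q k * (x k + p k)))
    (fun b hb => by rw [hchar x b (Finset.mem_filter.1 hb).2]), Finset.sum_const, nsmul_eq_mul]
  change _ = K * N * catAmplitude p (∑ k, q k) x
  unfold catAmplitude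
  by_cases h0 : x = p
  · subst h0
    simp [zmod_two_add_self, bitSign_zero, hN, hP]
  · rw [if_neg h0]
    by_cases h1 : x = p + 1
    · subst h1
      have : (∑ k, q k * ((p + 1) k + p k)) = ∑ k, q k := by
        refine Finset.sum_congr rfl fun k _ => ?_
        have : ∀ a b : ZMod 2, b * (a + 1 + a) = b := by decide
        exact this _ _
      rw [this, if_pos rfl, hcard]; ring
    · rw [if_neg h1, Finset.filter_false_of_mem]
      · simp
      · intro b _ hb
        rcases hD.const _ _ (hsol x b hb) with h | h
        · exact h0 (by rw [← bits_add_add n x p, h, zero_add])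
        · exact h1 (by rw [← bits_add_add n x p, h, add_comm])

/-- The sum of two solutions is an unflipped one, so all solutions lie over some `x` and over `x +
1`. Adding the all-ones solution `b1` is a bijection between the two sets that multiplies every sign
by the same factor, determined by the pairing `a` of the `Z` part of the fault with `b1`. The
amplitude at `x` itself may involve cancellation, but it is nonzero by undetectability and serves as
the global scalar. -/
theorem interp_undetectable (hD : D.IsCatLike out) (F : D.Fault)
    (hF : ¬F.Detectable) :
    ∃ (α : ℂ) (a : ZMod 2) (x : Fin n → ZMod 2) (b : D.Edge × Bool → ZMod 2), α ≠ 0 ∧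
      D.IsSol (fun e => (F e).xBit) x b ∧ (a ≠ 0 → ∃ e, F e ≠ .I) ∧
      D.interp F = α • catAmplitude x a := by
  classical
  obtain ⟨K, hK, hint⟩ := D.interp_eq hD.phase_eq F
  obtain ⟨b1, hb1⟩ := hD.exists_ones
  obtain ⟨x, hx⟩ : ∃ x : Fin n → ZMod 2, D.interp F x ≠ 0 := by
    by_contra! h
    exact hF (funext h)
  obtain ⟨b, hb⟩ : ∃ b, D.IsSol (fun e => (F e).xBit) x b := by
    by_contra! h
    apply hx
    rw [hint x, Finset.filter_false_of_mem (fun b _ => h b)]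
    simp
  set a : ZMod 2 := ∑ e, (F e).zBit * b1 (e, false)
  refine ⟨D.interp F x, a, x, b, hx, hb, fun ha => ?_, ?_⟩
  · by_contra! h
    exact ha (Finset.sum_eq_zero fun e _ => by simp [h e, Pauli.zBit])
  funext y
  change Fin n → ZMod 2 at y
  change _ = D.interp F x * catAmplitude x a y
  unfold catAmplitude
  by_cases h0 : y = x
  · rw [if_pos h0, h0, mul_one]
  rw [if_neg h0]
  by_cases h1 : y = x + 1
  · subst h1
    rw [if_pos rfl, hint, hint, mul_assoc, Finset.sum_mul]
    congr 1
    refine Finset.sum_bij' (fun b _ => b + b1) (fun b _ => b + b1) ?_ ?_ ?_ ?_ ?_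
    · intro b hb
      simp only [Finset.mem_filter, Finset.mem_univ, true_and] at hb ⊢
      have := hb.add hb1
      rwa [add_zero, bits_add_add] at this
    · intro b hb
      simp only [Finset.mem_filter, Finset.mem_univ, true_and] at hb ⊢
      have := hb.add hb1
      rwa [add_zero] at this
    · intro b _
      rw [add_assoc, add_self_bits, add_zero]
    · intro b _
      rw [add_assoc, add_self_bits, add_zero]
    · intro b _
      simp only [Pi.add_apply, mul_add, Finset.sum_add_distrib, bitSign_add]
      rw [mul_assoc, bitSign_mul_self, mul_one]
  · rw [if_neg h1, hint, Finset.filter_false_of_mem]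
    · simp
    · intro b' _ hb'
      have := hb.add hb'
      rw [add_self_bits] at this
      rcases hD.const _ _ this with h | h
      · refine h0 ?_
        rw [← bits_add_add n y x, add_comm y, h, zero_add]
      · refine h1 ?_
        rw [← bits_add_add n y x, add_comm y, h, add_comm]

end IsCatLike

theorem isCatLike_cat (hn : 0 < n) : (cat n).IsCatLike id where
  phase_eq _ := rfl
  out_injective := Function.injective_id
  attach_out _ := rfl
  exists_ones := by
    refine ⟨1, fun e => by simp, fun s => ⟨fun _ _ _ _ _ => rfl, fun h => ?_⟩, fun _ _ _ => rfl⟩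
    exact absurd h (by simp [cat])
  const x b hb := by
    have hx : ∀ k, x k = b ((⟨0, hn⟩ : Fin n), false) := by
      intro k
      have h1 := hb.2.2 ((k : Fin n), true) k rfl
      refine h1.symm.trans ((hb.1 k).trans ((add_zero _).trans ?_))
      refine (hb.2.1 ()).1 rfl _ ?_ _ ?_ <;>
        exact Finset.mem_filter.2 ⟨Finset.mem_univ _, rfl⟩
    rcases zmod_two_cases (b ((⟨0, hn⟩ : Fin n), false)) with h | h
    · exact Or.inl (funext fun k => (hx k).trans h)
    · exact Or.inr (funext fun k => (hx k).trans h)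

/-- Flipping all qubits exchanges the two branches, which is a global sign. This is why flips on the
outputs matter only up to complementation. -/
theorem catAmplitude_add_one (hn : 0 < n) (d : Fin n → ZMod 2) (a : ZMod 2) :
    catAmplitude (d + 1) a = bitSign a • catAmplitude d a := by
  funext x
  change Fin n → ZMod 2 at x
  have h1 : ∀ y : Fin n → ZMod 2, y ≠ y + 1 := fun y h => zero_ne_ones hn (left_eq_add.1 h).symm
  change _ = bitSign a * catAmplitude d a x
  unfold catAmplitude
  rw [add_assoc, add_self_bits, add_zero]
  by_cases hx : x = d
  · subst hx
    rw [if_neg (h1 x), if_pos rfl, if_pos rfl, mul_one]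
  · by_cases hx' : x = d + 1
    · subst hx'
      rw [if_pos rfl, if_neg hx, if_pos rfl, bitSign_mul_self]
    · rw [if_neg hx', if_neg hx, if_neg hx, if_neg hx', mul_zero]

theorem scalarEq_smul_smul {α K : ℂ} (hα : α ≠ 0) (hK : K ≠ 0) (ψ : (Fin n → Fin 2) → ℂ) :
    ScalarEq (α • ψ) (K • ψ) :=
  ⟨α / K, div_ne_zero hα hK, by rw [smul_smul, div_mul_cancel₀ _ hK]⟩

/-- A diagram of the CAT state prepares it fault-tolerantly if few bit flips on its edges amount to
at most as many bit flips on the outputs. -/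
theorem IsCatLike.ftPreparesCat {D : ZXDiagram n} {out : Fin n → D.Edge} (hD : D.IsCatLike out)
    (hn : 0 < n) (t : ℕ)
    (H : ∀ p x b, D.IsSol p x b → (Finset.univ.filter fun e => p e ≠ 0).card ≤ t →
      ∃ d : Fin n → ZMod 2, (x = d ∨ x = d + 1) ∧
        (Finset.univ.filter fun k => d k ≠ 0).card ≤ (Finset.univ.filter fun e => p e ≠ 0).card) :
    D.FTPreparesCat t := by
  have hcat := isCatLike_cat hn
  constructor
  · intro F hF hw
    obtain ⟨α, a, x, b, hα, hb, ha, hint⟩ := hD.interp_undetectable F hF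
    have hle : (Finset.univ.filter fun e => (F e).xBit ≠ 0).card ≤ F.weight :=
      Finset.card_le_card (Finset.monotone_filter_right _ fun e _ he => Pauli.ne_I_of_xBit he)
    obtain ⟨d, hd, hdw⟩ := H _ x b hb (hle.trans (Nat.lt_succ_iff.1 hw))
    obtain ⟨q, hq, hqw⟩ : ∃ q : Fin n → ZMod 2, ∑ k, q k = a ∧
        (Finset.univ.filter fun k => d k ≠ 0 ∨ q k ≠ 0).card ≤ F.weight := by
      by_cases h0 : a = 0
      · exact ⟨0, by simp [h0], by simpa using hdw.trans hle⟩
      · obtain ⟨e, he⟩ := ha h0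
        have hpos : 0 < F.weight := Finset.card_pos.2 ⟨e, by simpa using he⟩
        obtain ⟨k, hk⟩ : ∃ k, d k ≠ 0 ∨ d = 0 := by
          by_cases hd0 : d = 0
          · exact ⟨⟨0, hn⟩, Or.inr hd0⟩
          · obtain ⟨k, hk⟩ := Function.ne_iff.1 hd0
            exact ⟨k, Or.inl hk⟩
        -- The `Z` goes on an output that is flipped anyway, turning `X` into `Y` at no extra
        -- weight. If no output is flipped, any output will do: the weight is then one, and `F` has
        -- weight at least one because `a ≠ 0`.
        refine ⟨Pi.single k a, by simp, ?_⟩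
        rcases hk with hk | hk
        · refine le_trans (Finset.card_le_card fun j hj => ?_) (hdw.trans hle)
          simp only [Finset.mem_filter, Finset.mem_univ, true_and] at hj ⊢
          rcases hj with hj | hj
          · exact hj
          · by_cases hjk : j = k
            · rwa [hjk]
            · exact absurd (Pi.single_eq_of_ne hjk _) hj
        · refine le_trans (Finset.card_le_one.2 ?_) hpos
          have : ∀ j, (d j ≠ 0 ∨ (Pi.single k a : Fin n → ZMod 2) j ≠ 0) → j = k := by
            intro j hj
            by_contra hjk
            simp [hk, Pi.single_eq_of_ne hjk] at hj
          intro i hi j hj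
          simp only [Finset.mem_filter, Finset.mem_univ, true_and] at hi hj
          rw [this i hi, this j hj]
    obtain ⟨K, hK, hint'⟩ := hcat.interp_outFault d q
    refine ⟨outFault (cat n) id d q, (hcat.weight_outFault d q).trans_le hqw, ?_⟩
    rw [hint, hint', hq]
    rcases hd with rfl | rfl
    · exact scalarEq_smul_smul hα hK _
    · rw [catAmplitude_add_one hn, ← mul_smul]
      exact scalarEq_smul_smul (mul_ne_zero hα (bitSign_ne_zero a)) hK _
  -- Conversely, the CAT diagram has only output edges, so its fault is copied to the output edges
  -- of `D` with the same weight.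
  · intro F _ _
    set p : Fin n → ZMod 2 := fun k => (F k).xBit
    set q : Fin n → ZMod 2 := fun k => (F k).zBit
    have hF : F = outFault (cat n) id p q := by
      funext k
      exact ((hcat.outFault_out p q k).trans (Pauli.ofBits_bits (F k))).symm
    obtain ⟨K, hK, hint⟩ := hD.interp_outFault p q
    obtain ⟨K', hK', hint'⟩ := hcat.interp_outFault p q
    refine ⟨D.outFault out p q, ?_, ?_⟩
    · rw [hD.weight_outFault, hF, hcat.weight_outFault]
    · rw [hF, hint, hint']
      exact scalarEq_smul_smul hK' hK _

end ZXDiagram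

/-! ### Wires, legs and classical bits of a CNOT circuit -/

namespace CNOTCircuit

variable {n : ℕ}

theorem find?_reverse_finRange_eq_some {L : ℕ} {P : Fin L → Bool} {j : Fin L} (hj : P j = true)
    (hmax : ∀ k, P k = true → k ≤ j) : (List.finRange L).reverse.find? P = some j := by
  cases hf : (List.finRange L).reverse.find? P with
  | none => exact absurd hj (by simpa using List.find?_eq_none.1 hf j (by simp))
  | some k =>
    obtain ⟨hk, as, bs, hl, has⟩ := List.find?_eq_some_iff_append.1 hf
    have hsort : ((List.finRange L).reverse).Pairwise (· > ·) := by
      rw [List.pairwise_reverse]; exact List.pairwise_lt_finRange L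
    have hmem : j ∈ as ++ k :: bs := hl ▸ (by simp)
    rw [hl, List.pairwise_append] at hsort
    rcases List.mem_append.1 hmem with h | h
    · simpa [hj] using has j h
    · rcases List.mem_cons.1 h with h | h
      · rw [h]
      · exact absurd (hmax k hk) (not_le.2 ((List.pairwise_cons.1 hsort.2.1).1 j h))

variable (C : CNOTCircuit n)

theorem gateQubit_ne (i : C.GateIdx) : C.gateQubit (i, false) ≠ C.gateQubit (i, true) := by
  simpa [gateQubit] using C.control_ne_target _ (List.get_mem C.gates i)

theorem lastOn_zero (w : C.Qubit) : C.lastOn w 0 = Sum.inl w := by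
  have : (List.finRange C.gates.length).reverse.find?
      (fun j : C.GateIdx =>
        decide ((j : ℕ) < 0 ∧ (C.gateQubit (j, false) = w ∨ C.gateQubit (j, true) = w))) = none :=
    List.find?_eq_none.2 (by simp)
  rw [lastOn, this]

theorem lastOn_succ_of_ne {w : C.Qubit} {i : C.GateIdx} (h : ∀ c, C.gateQubit (i, c) ≠ w) :
    C.lastOn w (i + 1) = C.lastOn w i := by
  have : ∀ j : C.GateIdx,
      ((j : ℕ) < i + 1 ∧ (C.gateQubit (j, false) = w ∨ C.gateQubit (j, true) = w)) ↔
      ((j : ℕ) < i ∧ (C.gateQubit (j, false) = w ∨ C.gateQubit (j, true) = w)) := by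
    intro j
    constructor
    · rintro ⟨h1, h2⟩
      refine ⟨lt_of_le_of_ne (Nat.lt_succ_iff.1 h1) fun hji => ?_, h2⟩
      rw [Fin.ext hji] at h2
      exact h2.elim (h _) (h _)
    · rintro ⟨h1, h2⟩
      exact ⟨h1.trans (Nat.lt_succ_self _), h2⟩
  simp only [lastOn, this]

theorem lastOn_succ_of_eq {w : C.Qubit} {i : C.GateIdx} {c : Bool} (h : C.gateQubit (i, c) = w) :
    C.lastOn w (i + 1) = Sum.inr (Sum.inl (i, c)) := by
  have : (List.finRange C.gates.length).reverse.find?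
      (fun j : C.GateIdx => decide ((j : ℕ) < i + 1 ∧
        (C.gateQubit (j, false) = w ∨ C.gateQubit (j, true) = w))) = some i := by
    refine find?_reverse_finRange_eq_some ?_ fun k hk => ?_
    · rw [decide_eq_true_iff]
      refine ⟨Nat.lt_succ_self _, ?_⟩
      cases c
      · exact Or.inl h
      · exact Or.inr h
    · rw [decide_eq_true_iff] at hk
      exact Nat.lt_succ_iff.1 hk.1
  rw [lastOn, this]
  have hc : decide (C.gateQubit (i, true) = w) = c := by
    cases c
    · rw [decide_eq_false_iff_not]
      exact fun h' => C.gateQubit_ne i (h.trans h'.symm)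
    · rw [decide_eq_true_iff]; exact h
  simp only [hc]

theorem lastOn_ne_meas (w : C.Qubit) (i : ℕ) (j : Fin C.numAncillae) :
    C.lastOn w i ≠ Sum.inr (Sum.inr j) := by
  unfold lastOn
  split <;> simp

/-- The wire on the qubit `w` just before time `i`. -/
def nextEdge (w : C.Qubit) (i : ℕ) : C.Edge :=
  if h : i < C.gates.length then
    if C.gateQubit (⟨i, h⟩, false) = w then Sum.inr (Sum.inl (⟨i, h⟩, false))
    else if C.gateQubit (⟨i, h⟩, true) = w then Sum.inr (Sum.inl (⟨i, h⟩, true))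
    else nextEdge w (i + 1)
  else Sum.inl w
termination_by C.gates.length - i

theorem nextEdge_length (w : C.Qubit) : C.nextEdge w C.gates.length = Sum.inl w := by
  rw [nextEdge, dif_neg (lt_irrefl _)]

theorem nextEdge_of_eq {w : C.Qubit} {i : C.GateIdx} {c : Bool} (h : C.gateQubit (i, c) = w) :
    C.nextEdge w i = Sum.inr (Sum.inl (i, c)) := by
  rw [nextEdge, dif_pos i.2]
  cases c
  · rw [if_pos h]
  · rw [if_neg fun h' => C.gateQubit_ne i (h'.trans h.symm), if_pos h]

theorem nextEdge_of_ne {w : C.Qubit} {i : C.GateIdx} (h : ∀ c, C.gateQubit (i, c) ≠ w) :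
    C.nextEdge w i = C.nextEdge w (i + 1) := by
  rw [nextEdge, dif_pos i.2, if_neg (h false), if_neg (h true)]

theorem forall_ne_or_exists_eq (w : C.Qubit) (i : C.GateIdx) :
    (∀ c, C.gateQubit (i, c) ≠ w) ∨ ∃ c, C.gateQubit (i, c) = w := by
  by_cases h : ∃ c, C.gateQubit (i, c) = w
  · exact Or.inr h
  · exact Or.inl (by simpa using h)

theorem time_induction {P : ℕ → Prop} (h0 : P C.gates.length)
    (hs : ∀ i : C.GateIdx, P (i + 1) → P i) {i : ℕ} (hi : i ≤ C.gates.length) : P i :=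
  Nat.decreasingInduction (motive := fun k _ => P k) (fun k hk h => hs ⟨k, hk⟩ h) h0 hi

theorem attach_nextEdge (w : C.Qubit) {i : ℕ} (hi : i ≤ C.gates.length) :
    C.attach (C.nextEdge w i, false) = Sum.inl (C.lastOn w i) := by
  refine C.time_induction (P := fun i => C.attach (C.nextEdge w i, false) = Sum.inl (C.lastOn w i))
    ?_ (fun i ih => ?_) hi
  · rw [nextEdge_length]; rfl
  · rcases C.forall_ne_or_exists_eq w i with h | ⟨c, h⟩
    · rw [C.nextEdge_of_ne h, ih, C.lastOn_succ_of_ne h]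
    · rw [C.nextEdge_of_eq h, ← h]; rfl

theorem nextEdge_ne_gate (w : C.Qubit) {i : ℕ} (hi : i ≤ C.gates.length) (j : C.GateIdx) :
    C.nextEdge w i ≠ Sum.inr (Sum.inr j) := by
  refine C.time_induction (P := fun i => C.nextEdge w i ≠ Sum.inr (Sum.inr j))
    ?_ (fun i ih => ?_) hi
  · rw [nextEdge_length]; simp
  · rcases C.forall_ne_or_exists_eq w i with h | ⟨c, h⟩
    · rwa [C.nextEdge_of_ne h]
    · rw [C.nextEdge_of_eq h]; simp

/-- The wire leaving a spider. -/
def outEdge : C.Spider → C.Edge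
  | Sum.inl w => C.nextEdge w 0
  | Sum.inr (Sum.inl p) => C.nextEdge (C.gateQubit p) (p.1 + 1)
  | Sum.inr (Sum.inr j) => Sum.inl (Sum.inr j)

/-- Links the forward search in `nextEdge` with the backward search in `lastOn`: the wire present at
a given time is the one that leaves the last earlier spider. The legs of every spider can then be
listed explicitly. -/
theorem nextEdge_eq_outEdge (w : C.Qubit) {i : ℕ} (hi : i ≤ C.gates.length) :
    C.nextEdge w i = C.outEdge (C.lastOn w i) := by
  induction i with
  | zero => rw [lastOn_zero]; rfl
  | succ i ih =>
    have hi' : i < C.gates.length := hi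
    rcases C.forall_ne_or_exists_eq w ⟨i, hi'⟩ with h | ⟨c, h⟩
    · have h1 := C.nextEdge_of_ne h
      have h2 := C.lastOn_succ_of_ne h
      simp only at h1 h2
      rw [← h1, h2, ih hi'.le]
    · have h2 := C.lastOn_succ_of_eq h
      simp only at h2
      rw [h2, outEdge, h]

theorem attach_false_eq {e : C.Edge} {s : C.Spider} (h : C.attach (e, false) = Sum.inl s) :
    e = C.outEdge s ∧ (∀ j, s ≠ Sum.inr (Sum.inr j)) ∨
      ∃ i, e = Sum.inr (Sum.inr i) ∧ s = Sum.inr (Sum.inl (i, false)) := by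
  rcases e with w | p | i
  · obtain rfl : C.lastOn w C.gates.length = s := Sum.inl_injective h
    rw [← C.nextEdge_eq_outEdge w le_rfl, nextEdge_length]
    exact Or.inl ⟨rfl, C.lastOn_ne_meas _ _⟩
  · obtain rfl : C.lastOn (C.gateQubit p) p.1 = s := Sum.inl_injective h
    rw [← C.nextEdge_eq_outEdge _ p.1.2.le, C.nextEdge_of_eq rfl]
    exact Or.inl ⟨rfl, C.lastOn_ne_meas _ _⟩
  · exact Or.inr ⟨i, rfl, (Sum.inl_injective h).symm⟩

/-- The legs of a spider of the associated diagram. -/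
def spiderLegs (s : C.Spider) : Finset (C.Edge × Bool) :=
  Finset.univ.filter fun h => C.attach h = Sum.inl s

theorem isSol_iff {p : C.Edge → ZMod 2} {x : Fin n → ZMod 2} {b : C.Edge × Bool → ZMod 2} :
    C.associatedDiagram.IsSol p x b ↔ (∀ e, b (e, true) = b (e, false) + p e) ∧
      (∀ s, (C.spiderColor s = .Z → ∀ h ∈ C.spiderLegs s, ∀ h' ∈ C.spiderLegs s, b h = b h') ∧
        (C.spiderColor s = .X → ∑ h ∈ C.spiderLegs s, b h = 0)) ∧
      ∀ h k, C.attach h = Sum.inr k → b h = x k :=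
  Iff.rfl

theorem mem_legs {s : C.Spider} {h : C.Edge × Bool} :
    h ∈ C.spiderLegs s ↔ C.attach h = Sum.inl s := by
  simp only [spiderLegs, Finset.mem_filter, Finset.mem_univ, true_and]

theorem legs_prep (w : C.Qubit) :
    C.spiderLegs (Sum.inl w : C.Spider) = {(C.nextEdge w 0, false)} := by
  ext ⟨e, c⟩
  rw [mem_legs, Finset.mem_singleton]
  constructor
  · intro h
    cases c
    · rcases C.attach_false_eq h with ⟨rfl, -⟩ | ⟨i, -, hi⟩
      · rfl
      · simp at hi
    · rcases e with (w | w) | p | i <;> simp [attach, lineEnd] at h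
  · intro h
    obtain ⟨rfl, rfl⟩ := Prod.mk.inj h
    rw [C.attach_nextEdge w (Nat.zero_le _), lastOn_zero]

theorem legs_meas (j : Fin C.numAncillae) :
    C.spiderLegs (Sum.inr (Sum.inr j) : C.Spider) = {(Sum.inl (Sum.inr j), true)} := by
  ext ⟨e, c⟩
  rw [mem_legs, Finset.mem_singleton]
  constructor
  · intro h
    cases c
    · rcases C.attach_false_eq h with ⟨-, hj⟩ | ⟨i, -, hi⟩
      · exact absurd rfl (hj j)
      · simp at hi
    · rcases e with (w | w) | p | i <;> simp [attach, lineEnd] at h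
      rw [h]
  · intro h
    obtain ⟨rfl, rfl⟩ := Prod.mk.inj h
    rfl

theorem legs_gate (i : C.GateIdx) (c : Bool) :
    C.spiderLegs (Sum.inr (Sum.inl (i, c)) : C.Spider) =
      {(Sum.inr (Sum.inl (i, c)), true), (Sum.inr (Sum.inr i), c),
        (C.nextEdge (C.gateQubit (i, c)) (i + 1), false)} := by
  ext ⟨e, c'⟩
  rw [mem_legs, Finset.mem_insert, Finset.mem_insert, Finset.mem_singleton]
  constructor
  · intro h
    cases c'
    · rcases C.attach_false_eq h with ⟨rfl, -⟩ | ⟨i', rfl, hi⟩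
      · exact Or.inr (Or.inr rfl)
      · simp only [Sum.inr.injEq, Sum.inl.injEq, Prod.mk.injEq] at hi
        rw [hi.1, hi.2]; simp
    · rcases e with (w | w) | p | i <;> simp [attach, lineEnd] at h
      · rw [h]; exact Or.inl rfl
      · rw [h.1, ← h.2]; simp
  · rintro (h | h | h) <;> obtain ⟨rfl, rfl⟩ := Prod.mk.inj h
    · rfl
    · rfl
    · rw [C.attach_nextEdge _ (Nat.succ_le_of_lt i.2), C.lastOn_succ_of_eq rfl]

theorem sum_legs_gate (i : C.GateIdx) (c : Bool) (b : C.Edge × Bool → ZMod 2) :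
    ∑ h ∈ C.spiderLegs (Sum.inr (Sum.inl (i, c)) : C.Spider), b h =
      b (Sum.inr (Sum.inl (i, c)), true) + (b (Sum.inr (Sum.inr i), c) +
        b (C.nextEdge (C.gateQubit (i, c)) (i + 1), false)) := by
  have hne := C.nextEdge_ne_gate (C.gateQubit (i, c)) (Nat.succ_le_of_lt i.2) i
  rw [legs_gate]
  refine (Finset.sum_insert ?_).trans (congrArg _ (Finset.sum_pair ?_))
  · simp
  · exact fun h => hne (Prod.mk.inj h).1.symm

/-- The bit on the qubit `w` just before time `i`. -/
def bitAt (b : C.Edge × Bool → ZMod 2) (i : ℕ) (w : C.Qubit) : ZMod 2 := b (C.nextEdge w i, false)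

variable {C}

theorem bitAt_succ_of_ne (b : C.Edge × Bool → ZMod 2) {w : C.Qubit} {i : C.GateIdx}
    (h : ∀ c, C.gateQubit (i, c) ≠ w) : C.bitAt b (i + 1) w = C.bitAt b i w := by
  rw [bitAt, bitAt, C.nextEdge_of_ne h]

section Solutions

variable {p : C.Edge → ZMod 2} {x : Fin n → ZMod 2} {b : C.Edge × Bool → ZMod 2}

theorem bitAt_wire (hb : C.associatedDiagram.IsSol p x b) (q : C.GateIdx × Bool) :
    b (Sum.inr (Sum.inl q), true) =
      C.bitAt b q.1 (C.gateQubit q) + p (Sum.inr (Sum.inl q)) := by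
  rw [(C.isSol_iff.1 hb).1, bitAt, C.nextEdge_of_eq rfl]

theorem bitAt_zero (hb : C.associatedDiagram.IsSol p x b) {w : C.Qubit} (hw : C.prep w = .Z) :
    C.bitAt b 0 w = 0 := by
  have h := ((C.isSol_iff.1 hb).2.1 (Sum.inl w)).2 (by simp [spiderColor, hw])
  rwa [legs_prep, Finset.sum_singleton] at h

theorem bit_gateEdge (hb : C.associatedDiagram.IsSol p x b) (i : C.GateIdx) :
    b (Sum.inr (Sum.inr i), false) = C.bitAt b (i + 1) (C.gateQubit (i, false)) :=
  ((C.isSol_iff.1 hb).2.1 (Sum.inr (Sum.inl (i, false)))).1 rfl _ (by simp [legs_gate]) _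
    (by simp [legs_gate])

theorem bitAt_control (hb : C.associatedDiagram.IsSol p x b) (i : C.GateIdx) :
    C.bitAt b (i + 1) (C.gateQubit (i, false)) =
      C.bitAt b i (C.gateQubit (i, false)) + p (Sum.inr (Sum.inl (i, false))) := by
  rw [← bitAt_wire hb (i, false)]
  exact ((C.isSol_iff.1 hb).2.1 (Sum.inr (Sum.inl (i, false)))).1 rfl _ (by simp [legs_gate]) _
    (by simp [legs_gate])

/-- The spider of the control copies the bit that remains after a flip on the incoming control wire,
hence time `i + 1` on the control in the sum. -/
theorem bitAt_target (hb : C.associatedDiagram.IsSol p x b) (i : C.GateIdx) :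
    C.bitAt b (i + 1) (C.gateQubit (i, true)) =
      C.bitAt b i (C.gateQubit (i, true)) + p (Sum.inr (Sum.inl (i, true))) +
        (C.bitAt b (i + 1) (C.gateQubit (i, false)) + p (Sum.inr (Sum.inr i))) := by
  have h := ((C.isSol_iff.1 hb).2.1 (Sum.inr (Sum.inl (i, true)))).2 rfl
  rw [sum_legs_gate, bitAt_wire hb, (C.isSol_iff.1 hb).1 (Sum.inr (Sum.inr i)),
    bit_gateEdge hb] at h
  rw [← add_assoc] at h
  exact (CharTwo.add_eq_zero.1 h).symm

theorem bitAt_output (hb : C.associatedDiagram.IsSol p x b) (k : Fin n) :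
    x k = C.bitAt b C.gates.length (Sum.inl k) + p (Sum.inl (Sum.inl k)) := by
  rw [← (C.isSol_iff.1 hb).2.2 (Sum.inl (Sum.inl k), true) k rfl, (C.isSol_iff.1 hb).1, bitAt,
    nextEdge_length]

theorem bitAt_meas (hb : C.associatedDiagram.IsSol p x b) {j : Fin C.numAncillae}
    (hj : C.meas j = .Z) :
    C.bitAt b C.gates.length (Sum.inr j) + p (Sum.inl (Sum.inr j)) = 0 := by
  have h := ((C.isSol_iff.1 hb).2.1 (Sum.inr (Sum.inr j))).2 (by simp [spiderColor, hj])
  rw [legs_meas, Finset.sum_singleton, (C.isSol_iff.1 hb).1] at h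
  rwa [bitAt, nextEdge_length]

end Solutions

/-- A classical run of the circuit gives a solution. -/
theorem exists_isSol {σ : ℕ → C.Qubit → ZMod 2} {x : Fin n → ZMod 2}
    (hprep : ∀ w, C.prep w = .Z → σ 0 w = 0)
    (hskip : ∀ (i : C.GateIdx) (w : C.Qubit), (∀ c, C.gateQubit (i, c) ≠ w) → σ (i + 1) w = σ i w)
    (hcontrol : ∀ i : C.GateIdx, σ (i + 1) (C.gateQubit (i, false)) =
      σ i (C.gateQubit (i, false)))
    (htarget : ∀ i : C.GateIdx, σ (i + 1) (C.gateQubit (i, true)) =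
      σ i (C.gateQubit (i, true)) + σ i (C.gateQubit (i, false)))
    (hmeas : ∀ j, C.meas j = .Z → σ C.gates.length (Sum.inr j) = 0)
    (hout : ∀ k, σ C.gates.length (Sum.inl k) = x k) :
    ∃ b, C.associatedDiagram.IsSol 0 x b := by
  set f : C.Edge → ZMod 2 := fun e => match e with
    | Sum.inl w => σ C.gates.length w
    | Sum.inr (Sum.inl q) => σ q.1 (C.gateQubit q)
    | Sum.inr (Sum.inr i) => σ i (C.gateQubit (i, false)) with hf
  have hnext : ∀ (w : C.Qubit) (i : ℕ), i ≤ C.gates.length → f (C.nextEdge w i) = σ i w := by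
    intro w i hi
    refine C.time_induction (P := fun i => f (C.nextEdge w i) = σ i w) ?_ (fun i ih => ?_) hi
    · rw [nextEdge_length]
    · rcases C.forall_ne_or_exists_eq w i with h | ⟨c, h⟩
      · rw [C.nextEdge_of_ne h, ih, hskip i w h]
      · rw [C.nextEdge_of_eq h, ← h]
  refine ⟨fun h => f h.1, C.isSol_iff.2 ⟨fun e => (add_zero _).symm, fun s => ?_, ?_⟩⟩
  · rcases s with w | ⟨i, c⟩ | j
    · rw [legs_prep]
      refine ⟨fun _ h hh h' hh' => ?_, fun hc => ?_⟩
      · rw [Finset.mem_singleton.1 hh, Finset.mem_singleton.1 hh']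
      · rw [Finset.sum_singleton]
        refine (hnext w 0 (Nat.zero_le _)).trans (hprep w ?_)
        cases hw : C.prep w
        · rfl
        · simp [spiderColor, hw] at hc
    · have hn := hnext (C.gateQubit (i, c)) (i + 1) (Nat.succ_le_of_lt i.2)
      cases c
      · refine ⟨fun _ => ?_, fun hc => by simp [spiderColor] at hc⟩
        have : ∀ h ∈ C.spiderLegs (Sum.inr (Sum.inl (i, false))),
            f h.1 = σ i (C.gateQubit (i, false)) := by
          intro h hh
          simp only [legs_gate, Finset.mem_insert, Finset.mem_singleton] at hh
          rcases hh with rfl | rfl | rfl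
          · rfl
          · rfl
          · exact hn.trans (hcontrol i)
        exact fun h hh h' hh' => (this h hh).trans (this h' hh').symm
      · refine ⟨fun hc => by simp [spiderColor] at hc, fun _ => ?_⟩
        rw [sum_legs_gate, hn, htarget]
        change σ i (C.gateQubit (i, true)) + (σ i (C.gateQubit (i, false)) + _) = 0
        rw [← add_assoc]
        exact zmod_two_add_self _
    · rw [legs_meas]
      refine ⟨fun _ h hh h' hh' => ?_, fun hc => ?_⟩
      · rw [Finset.mem_singleton.1 hh, Finset.mem_singleton.1 hh']
      · rw [Finset.sum_singleton]
        refine hmeas j ?_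
        cases hw : C.meas j
        · rfl
        · simp [spiderColor, hw] at hc
  · intro h k hk
    obtain rfl := (C.associatedDiagram.output_degree k).unique
      (y₁ := h) (y₂ := (Sum.inl (Sum.inl k), true)) hk rfl
    exact hout k

end CNOTCircuit

/-! ### Schedules, circuits realizing them, and the charging of flips -/

/-- A schedule of the ports of a graph with vertices `V`, marks `M` and segments `Sg`: every port
gets one of three layers, the ports at a node in different layers, and the ports of a segment as
well, unless it is one of the direct segments `S`, which join vertices and use the first layer. -/
structure PortSchedule {V M Sg : Type} (node : Sg × Bool → V ⊕ M) (S : Finset Sg) where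
  layer : Sg × Bool → Fin 3
  layer_ne : ∀ π π', node π = node π' → π ≠ π' → layer π ≠ layer π'
  layer_seg_ne : ∀ s ∉ S, layer (s, false) ≠ layer (s, true)
  layer_direct : ∀ s ∈ S, ∀ c, layer (s, c) = 0
  direct_vertex : ∀ s ∈ S, ∀ c, ∃ v, node (s, c) = Sum.inl v
  exists_layer : ∀ v l, ∃ π, node π = Sum.inl v ∧ layer π = l
  mark_ports : ∀ m, ∃ π π', ∀ ρ, node ρ = Sum.inr m → ρ = π ∨ ρ = π'

namespace CNOTCircuit

variable {n : ℕ}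

/-- The qubit of a node. -/
def nodeQubit {C : CNOTCircuit n} {V M : Type} (vert : V → Fin C.numAncillae) (mark : M ≃ Fin n) :
    V ⊕ M → C.Qubit :=
  Sum.elim (fun v => Sum.inr (vert v)) fun m => Sum.inl (mark m)

/-- The circuit `C` realizes a graph with a schedule: the marks are the outputs, the vertices and
the segments that are not direct are ancillae, and every port is a CNOT gate from its node to its
segment, except that a direct segment is a single CNOT gate between its nodes. -/
structure Realizes (C : CNOTCircuit n) {V M Sg : Type} {node : Sg × Bool → V ⊕ M} {S : Finset Sg}
    (T : PortSchedule node S) where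
  mark : M ≃ Fin n
  vert : V → Fin C.numAncillae
  seg : {s // s ∉ S} → Fin C.numAncillae
  vert_injective : Function.Injective vert
  seg_injective : Function.Injective seg
  vert_ne_seg : ∀ v s, vert v ≠ seg s
  vert_or_seg : ∀ j, (∃ v, vert v = j) ∨ ∃ s, seg s = j
  gate : Sg × Bool → C.GateIdx
  gate_surjective : Function.Surjective gate
  gate_inj : ∀ π π', gate π = gate π' → π = π' ∨ π.1 ∈ S ∧ π.1 = π'.1
  gate_direct : ∀ s ∈ S, gate (s, true) = gate (s, false)
  gate_lt : ∀ π π', node π = node π' → T.layer π < T.layer π' → gate π < gate π'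
  control : ∀ π : Sg × Bool, (π.1 ∉ S ∨ π.2 = false) →
    C.gateQubit (gate π, false) = nodeQubit vert mark (node π)
  target_seg : ∀ s c, C.gateQubit (gate (s.1, c), true) = Sum.inr (seg s)
  target_direct : ∀ s ∈ S, C.gateQubit (gate (s, true), true) = nodeQubit vert mark (node (s, true))
  prep_seg : ∀ s, C.prep (Sum.inr (seg s)) = .Z
  meas_seg : ∀ s, C.meas (seg s) = .Z
  meas_vert : ∀ v, C.meas (vert v) = .X
  prep_node : ∀ u, C.prep (nodeQubit vert mark u) = .Z ↔ ∃ s ∈ S, node (s, true) = u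

theorem bitAt_eq_of_forall_ne {C : CNOTCircuit n} (b : C.Edge × Bool → ZMod 2) {w : C.Qubit}
    {i j : ℕ} (hij : i ≤ j) (hj : j ≤ C.gates.length)
    (h : ∀ k : C.GateIdx, i ≤ k → (k : ℕ) < j → ∀ c, C.gateQubit (k, c) ≠ w) :
    C.bitAt b j w = C.bitAt b i w := by
  induction j, hij using Nat.le_induction with
  | base => rfl
  | succ j hij ih =>
    rw [bitAt_succ_of_ne (i := ⟨j, hj⟩) b (h ⟨j, hj⟩ hij (Nat.lt_succ_self j))]
    exact ih (Nat.le_of_succ_le hj) fun k hk hkj => h k hk (hkj.trans (Nat.lt_succ_self j))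

namespace Realizes

variable {C : CNOTCircuit n} {V M Sg : Type} {node : Sg × Bool → V ⊕ M} {S : Finset Sg}
  {T : PortSchedule node S} (R : C.Realizes T)

/-- The qubit of a node. -/
abbrev qubit (u : V ⊕ M) : C.Qubit := nodeQubit R.vert R.mark u

theorem qubit_injective : Function.Injective R.qubit := by
  rintro (v | m) (v' | m') h <;> simp [qubit, nodeQubit] at h
  · rw [R.vert_injective h]
  · rw [h]

theorem qubit_ne_seg (u : V ⊕ M) (s : {s // s ∉ S}) : R.qubit u ≠ Sum.inr (R.seg s) := by
  rcases u with v | m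
  · exact fun h => R.vert_ne_seg v s (Sum.inr_injective h)
  · exact Sum.inl_ne_inr

theorem exists_of_target_node {k : C.GateIdx} {u : V ⊕ M}
    (h : C.gateQubit (k, true) = R.qubit u) :
    ∃ s ∈ S, node (s, true) = u ∧ R.gate (s, true) = k := by
  obtain ⟨⟨s, c⟩, rfl⟩ := R.gate_surjective k
  by_cases hs : s ∈ S
  · have hc : R.gate (s, c) = R.gate (s, true) := by
      cases c
      · exact (R.gate_direct s hs).symm
      · rfl
    rw [hc, R.target_direct s hs] at h
    exact ⟨s, hs, R.qubit_injective h, hc.symm⟩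
  · rw [R.target_seg ⟨s, hs⟩ c] at h
    exact absurd h.symm (R.qubit_ne_seg _ _)

theorem exists_control_port (k : C.GateIdx) :
    ∃ π : Sg × Bool, (π.1 ∉ S ∨ π.2 = false) ∧ R.gate π = k := by
  obtain ⟨⟨s, c⟩, rfl⟩ := R.gate_surjective k
  by_cases hs : s ∈ S
  · refine ⟨(s, false), Or.inr rfl, ?_⟩
    cases c
    · rfl
    · exact (R.gate_direct s hs).symm
  · exact ⟨(s, c), Or.inl hs, rfl⟩

theorem exists_port {k : C.GateIdx} {c : Bool} {u : V ⊕ M}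
    (h : C.gateQubit (k, c) = R.qubit u) : ∃ π, node π = u ∧ R.gate π = k := by
  cases c
  · obtain ⟨π, hπ, rfl⟩ := R.exists_control_port k
    rw [R.control π hπ] at h
    exact ⟨π, R.qubit_injective h, rfl⟩
  · obtain ⟨s, -, h1, h2⟩ := R.exists_of_target_node h
    exact ⟨_, h1, h2⟩

theorem exists_of_seg {k : C.GateIdx} {c : Bool} {s : {s // s ∉ S}}
    (h : C.gateQubit (k, c) = Sum.inr (R.seg s)) : ∃ c', R.gate (s.1, c') = k := by
  cases c
  · obtain ⟨π, hπ, rfl⟩ := R.exists_control_port k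
    rw [R.control π hπ] at h
    exact absurd h (R.qubit_ne_seg _ _)
  · obtain ⟨⟨s', c⟩, rfl⟩ := R.gate_surjective k
    by_cases hs : s' ∈ S
    · have hc : R.gate (s', c) = R.gate (s', true) := by
        cases c
        · exact (R.gate_direct s' hs).symm
        · rfl
      rw [hc, R.target_direct s' hs] at h
      exact absurd h (R.qubit_ne_seg _ _)
    · rw [R.target_seg ⟨s', hs⟩ c] at h
      have := R.seg_injective (Sum.inr_injective h)
      exact ⟨c, by rw [← this]⟩

theorem layer_lt {π π' : Sg × Bool} (h : node π = node π') (hg : R.gate π < R.gate π') :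
    T.layer π < T.layer π' := by
  rcases lt_trichotomy (T.layer π) (T.layer π') with hl | hl | hl
  · exact hl
  · by_cases hp : π = π'
    · rw [hp] at hg; exact absurd hg (lt_irrefl _)
    · exact absurd hl (T.layer_ne _ _ h hp)
  · exact absurd (R.gate_lt _ _ h.symm hl) (not_lt.2 hg.le)

theorem gate_seg_ne (s : {s // s ∉ S}) : R.gate (s.1, false) ≠ R.gate (s.1, true) := by
  intro h
  rcases R.gate_inj _ _ h with h | h
  · simp at h
  · exact s.2 h.1

section Solutions

variable (b : C.Edge × Bool → ZMod 2)

/-- The bit on the qubit of the node of a port just before its gate. -/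
def pre (π : Sg × Bool) : ZMod 2 := C.bitAt b (R.gate π) (R.qubit (node π))

/-- The bit on the qubit of the node of a port just after its gate. -/
def post (π : Sg × Bool) : ZMod 2 := C.bitAt b (R.gate π + 1) (R.qubit (node π))

variable {b}

theorem pre_eq_post {π π' : Sg × Bool} (h : node π = node π') (hl : T.layer π < T.layer π')
    (hn : ∀ ρ, node ρ = node π → ¬(T.layer π < T.layer ρ ∧ T.layer ρ < T.layer π')) :
    R.pre b π' = R.post b π := by
  rw [pre, post, h]
  refine bitAt_eq_of_forall_ne b (R.gate_lt _ _ h hl) (R.gate π').2.le fun k hk hk' c hc => ?_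
  obtain ⟨ρ, hρ, rfl⟩ := R.exists_port hc
  exact hn ρ (hρ.trans h.symm)
    ⟨R.layer_lt (h.trans hρ.symm) (Fin.lt_def.2 hk), R.layer_lt hρ (Fin.lt_def.2 hk')⟩

theorem final_eq_post {π : Sg × Bool} (hn : ∀ ρ, node ρ = node π → ¬T.layer π < T.layer ρ) :
    C.bitAt b C.gates.length (R.qubit (node π)) = R.post b π := by
  refine bitAt_eq_of_forall_ne b (Nat.succ_le_of_lt (R.gate π).2) le_rfl fun k hk hk' c hc => ?_
  obtain ⟨ρ, hρ, rfl⟩ := R.exists_port hc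
  exact hn ρ hρ (R.layer_lt hρ.symm (Fin.lt_def.2 hk))

theorem pre_eq_initial {π : Sg × Bool} (hπ : T.layer π = 0) :
    R.pre b π = C.bitAt b 0 (R.qubit (node π)) := by
  refine bitAt_eq_of_forall_ne b (Nat.zero_le _) (R.gate π).2.le fun k hk hk' c hc => ?_
  obtain ⟨ρ, hρ, rfl⟩ := R.exists_port hc
  have := R.layer_lt hρ (Fin.lt_def.2 hk')
  rw [hπ] at this
  exact absurd this (Fin.not_lt_zero _)

variable {p : C.Edge → ZMod 2} {x : Fin n → ZMod 2}

theorem post_control (hb : C.associatedDiagram.IsSol p x b) {π : Sg × Bool}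
    (hπ : π.1 ∉ S ∨ π.2 = false) :
    R.post b π = R.pre b π + p (Sum.inr (Sum.inl (R.gate π, false))) := by
  have := bitAt_control hb (R.gate π)
  rwa [R.control π hπ] at this

/-- The ancilla of the segment starts at `0`, receives exactly the two bits of its ends, and must be
`0` when measured, so these bits cancel unless something on the line or the gate edges is flipped.
-/
theorem post_add_post (hb : C.associatedDiagram.IsSol p x b) (s : {s // s ∉ S})
    (hw : ∀ c, p (Sum.inr (Sum.inl (R.gate (s.1, c), true))) = 0)
    (hg : ∀ c, p (Sum.inr (Sum.inr (R.gate (s.1, c)))) = 0)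
    (he : p (Sum.inl (Sum.inr (R.seg s))) = 0) :
    R.post b (s.1, false) = R.post b (s.1, true) := by
  have step : ∀ c, C.bitAt b (R.gate (s.1, c) + 1) (Sum.inr (R.seg s)) =
      C.bitAt b (R.gate (s.1, c)) (Sum.inr (R.seg s)) + R.post b (s.1, c) := by
    intro c
    have := bitAt_target hb (R.gate (s.1, c))
    rwa [R.target_seg s c, hw c, hg c, R.control _ (Or.inl s.2), add_zero, add_zero] at this
  -- Either end may come first in time; here `c` is the earlier one.
  have main : ∀ c c', R.gate (s.1, c) < R.gate (s.1, c') → (∀ d, d = c ∨ d = c') →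
      R.post b (s.1, c) + R.post b (s.1, c') = 0 := by
    intro c c' hlt hcc
    have h0 : C.bitAt b (R.gate (s.1, c)) (Sum.inr (R.seg s)) = 0 := by
      rw [← bitAt_zero hb (R.prep_seg s)]
      refine bitAt_eq_of_forall_ne b (Nat.zero_le _) (R.gate _).2.le fun k hk hk' d hd => ?_
      obtain ⟨d', rfl⟩ := R.exists_of_seg hd
      rcases hcc d' with rfl | rfl
      · exact lt_irrefl _ hk'
      · exact lt_asymm hk' hlt
    have h1 : C.bitAt b (R.gate (s.1, c')) (Sum.inr (R.seg s)) =
        C.bitAt b (R.gate (s.1, c) + 1) (Sum.inr (R.seg s)) := by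
      refine bitAt_eq_of_forall_ne b hlt (R.gate _).2.le fun k hk hk' d hd => ?_
      obtain ⟨d', rfl⟩ := R.exists_of_seg hd
      rcases hcc d' with rfl | rfl
      · exact absurd hk (by omega)
      · exact lt_irrefl _ hk'
    have h2 : C.bitAt b C.gates.length (Sum.inr (R.seg s)) =
        C.bitAt b (R.gate (s.1, c') + 1) (Sum.inr (R.seg s)) := by
      refine bitAt_eq_of_forall_ne b (R.gate _).2 le_rfl fun k hk hk' d hd => ?_
      obtain ⟨d', rfl⟩ := R.exists_of_seg hd
      rcases hcc d' with rfl | rfl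
      · exact absurd (lt_trans hlt (Fin.lt_def.2 hk)) (lt_irrefl _)
      · exact absurd hk (by omega)
    have h3 := bitAt_meas hb (R.meas_seg s)
    rwa [he, add_zero, h2, step, h1, step, h0, zero_add] at h3
  refine CharTwo.add_eq_zero.1 ?_
  rcases lt_or_gt_of_ne (R.gate_seg_ne s) with h | h
  · exact main false true h (by decide)
  · rw [add_comm]; exact main true false h (by decide)

/-- The gate lies in the first layer, so its target still carries the prepared `0` and becomes a
copy of the control. -/
theorem post_direct (hb : C.associatedDiagram.IsSol p x b) {s : Sg} (hs : s ∈ S)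
    (hw : p (Sum.inr (Sum.inl (R.gate (s, true), true))) = 0)
    (hg : p (Sum.inr (Sum.inr (R.gate (s, true)))) = 0) :
    R.post b (s, false) = R.post b (s, true) := by
  have h := bitAt_target hb (R.gate (s, true))
  have h0 := R.pre_eq_initial (b := b) (T.layer_direct s hs true)
  rw [bitAt_zero hb ((R.prep_node _).2 ⟨s, hs, rfl⟩)] at h0
  have hc := R.control (s, false) (Or.inr rfl)
  rw [← R.gate_direct s hs] at hc
  rw [R.target_direct s hs, hw, hg, hc, add_zero, add_zero] at h
  change R.post b (s, true) = R.pre b (s, true) + _ at h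
  rw [h0, zero_add, R.gate_direct s hs] at h
  exact h.symm

end Solutions

/-- A flip on the wire arriving at the port `π'` changes the bit at the port `π` of the node. -/
def Charged (T : PortSchedule node S) (π' π : Sg × Bool) : Prop :=
  node π' = node π ∧
    (((∃ v, node π = Sum.inl v) ∧ (T.layer π = 0 ∧ T.layer π' = 1 ∨ π' = π ∧ T.layer π = 2)) ∨
      ((∃ m, node π = Sum.inr m) ∧ T.layer π < T.layer π'))

theorem eq_of_layer_eq {π π' : Sg × Bool} (h : node π = node π') (hl : T.layer π = T.layer π') :
    π = π' := by
  by_contra hne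
  exact T.layer_ne _ _ h hne hl

/-- At a vertex, a wire into the middle port charges the first port, a wire into the last port
charges that port itself, and a wire into the first port charges nothing, since it shifts all three
bits together. A mark has only two ports, so the later one can charge only the earlier one. -/
theorem Charged.unique {π' π₁ π₂ : Sg × Bool} (h₁ : Charged T π' π₁) (h₂ : Charged T π' π₂) :
    π₁ = π₂ := by
  obtain ⟨hn₁, h₁⟩ := h₁
  obtain ⟨hn₂, h₂⟩ := h₂
  have hn : node π₁ = node π₂ := hn₁.symm.trans hn₂
  rcases h₁ with ⟨⟨v₁, hv₁⟩, h₁⟩ | ⟨⟨m, hm⟩, h₁⟩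
  · rcases h₂ with ⟨-, h₂⟩ | ⟨⟨m₂, hm₂⟩, -⟩
    · rcases h₁ with ⟨h₁, h₁'⟩ | ⟨rfl, h₁⟩ <;> rcases h₂ with ⟨h₂, h₂'⟩ | ⟨rfl, h₂⟩
      · exact eq_of_layer_eq hn (h₁.trans h₂.symm)
      · rw [h₂] at h₁'; simp at h₁'
      · rw [h₁] at h₂'; simp at h₂'
      · rfl
    · rw [hn, hm₂] at hv₁; simp at hv₁
  · rcases h₂ with ⟨⟨v₂, hv₂⟩, -⟩ | ⟨-, h₂⟩
    · rw [hn, hv₂] at hm; simp at hm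
    · obtain ⟨ρ, ρ', hρ⟩ := T.mark_ports m
      have a₁ := hρ π₁ hm
      have a₂ := hρ π₂ (hn ▸ hm)
      have a' := hρ π' (hn₁.trans hm)
      have d₁ : π₁ ≠ π' := by rintro rfl; exact lt_irrefl _ h₁
      have d₂ : π₂ ≠ π' := by rintro rfl; exact lt_irrefl _ h₂
      rcases a₁ with rfl | rfl <;> rcases a₂ with rfl | rfl <;> rcases a' with rfl | rfl <;>
        first | rfl | exact absurd rfl d₁ | exact absurd rfl d₂

/-- Charging ports lie beyond the first layer, where the direct segments are. So the gate of a
charging port determines the port. -/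
theorem Charged.not_mem {π' π : Sg × Bool} (h : Charged T π' π) : π'.1 ∉ S := by
  intro hs
  have h0 := T.layer_direct π'.1 hs π'.2
  rcases h.2 with ⟨-, ⟨-, h1⟩ | ⟨rfl, h1⟩⟩ | ⟨-, h1⟩
  · rw [h0] at h1; simp at h1
  · rw [h0] at h1; simp at h1
  · rw [h0] at h1; exact absurd h1 (Fin.not_lt_zero _)

/-- The reference bits. Taking the middle of the three gates at a vertex ensures that one flip on
its line separates at most one port from the reference; from either extreme, one flip could separate
two ports. -/
theorem exists_node_values (b : C.Edge × Bool → ZMod 2) : ∃ β : V ⊕ M → ZMod 2,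
    (∀ π v, node π = Sum.inl v → T.layer π = 1 → R.post b π = β (Sum.inl v)) ∧
      ∀ m, C.bitAt b C.gates.length (Sum.inl (R.mark m)) = β (Sum.inr m) := by
  choose mid hmid hmid' using fun v => T.exists_layer v 1
  refine ⟨Sum.elim (fun v => R.post b (mid v))
    fun m => C.bitAt b C.gates.length (Sum.inl (R.mark m)), fun π v hv hπ => ?_, fun m => rfl⟩
  rw [eq_of_layer_eq (hv.trans (hmid v).symm) (hπ.trans (hmid' v).symm)]
  rfl

section Solutions

variable {b : C.Edge × Bool → ZMod 2} {p : C.Edge → ZMod 2} {x : Fin n → ZMod 2}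

/-- Between a port and the moment at which the reference bit of its node is read, the line passes at
most one further flip, and that flip lies on a wire that charges the port. -/
theorem post_eq (hb : C.associatedDiagram.IsSol p x b) {β : V ⊕ M → ZMod 2}
    (hv : ∀ π v, node π = Sum.inl v → T.layer π = 1 → R.post b π = β (Sum.inl v))
    (hm : ∀ m, C.bitAt b C.gates.length (Sum.inl (R.mark m)) = β (Sum.inr m)) (π : Sg × Bool)
    (hp : ∀ π', Charged T π' π → p (Sum.inr (Sum.inl (R.gate π', false))) = 0) :
    R.post b π = β (node π) := by
  cases hn : node π with
  | inl v =>
    have hπ : T.layer π = 0 ∨ T.layer π = 1 ∨ T.layer π = 2 := by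
      have : ∀ l : Fin 3, l = 0 ∨ l = 1 ∨ l = 2 := by decide
      exact this _
    obtain ⟨ρ, hρ, hρ1⟩ := T.exists_layer v 1
    have hρn : node ρ = node π := hρ.trans hn.symm
    rw [← hv ρ v hρ hρ1]
    have hgap : ∀ l l' k : Fin 3, (l' : ℕ) = l + 1 → ¬(l < k ∧ k < l') := by decide
    rcases hπ with h | h | h
    · have hch : Charged T ρ π := ⟨hρn, Or.inl ⟨⟨v, hn⟩, Or.inl ⟨h, hρ1⟩⟩⟩
      rw [R.post_control hb (Or.inl hch.not_mem), hp ρ hch, add_zero]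
      refine (R.pre_eq_post hρn.symm (by rw [h, hρ1]; decide) fun k _ => ?_).symm
      exact hgap _ _ _ (by rw [h, hρ1]; rfl)
    · rw [eq_of_layer_eq hρn (hρ1.trans h.symm)]
    · have hch : Charged T π π := ⟨rfl, Or.inl ⟨⟨v, hn⟩, Or.inr ⟨rfl, h⟩⟩⟩
      rw [R.post_control hb (Or.inl hch.not_mem), hp π hch, add_zero]
      refine R.pre_eq_post hρn (by rw [h, hρ1]; decide) fun k _ => ?_
      exact hgap _ _ _ (by rw [h, hρ1]; rfl)
  | inr m =>
    have hq : R.qubit (node π) = Sum.inl (R.mark m) := by rw [hn]; rfl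
    rw [← hm m]
    by_cases hlast : ∃ ρ, node ρ = node π ∧ T.layer π < T.layer ρ
    · obtain ⟨ρ, hρ, hl⟩ := hlast
      obtain ⟨κ, κ', hκ⟩ := T.mark_ports m
      have hne : π ≠ ρ := by rintro rfl; exact lt_irrefl _ hl
      have htwo : ∀ τ, node τ = node π → τ = π ∨ τ = ρ := by
        intro τ hτ
        rcases hκ τ (hτ.trans hn) with rfl | rfl <;> rcases hκ π hn with rfl | rfl <;>
          rcases hκ ρ (hρ.trans hn) with rfl | rfl <;> simp_all
      have hch : Charged T ρ π := ⟨hρ, Or.inr ⟨⟨m, hn⟩, hl⟩⟩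
      have h1 : R.pre b ρ = R.post b π := R.pre_eq_post hρ.symm hl fun k hk hkl => by
        rcases htwo k hk with rfl | rfl
        · exact lt_irrefl _ hkl.1
        · exact lt_irrefl _ hkl.2
      have h2 := R.final_eq_post (b := b) (π := ρ) fun k hk hkl => by
        rcases htwo k (hk.trans hρ) with rfl | rfl
        · exact lt_asymm hl hkl
        · exact lt_irrefl _ hkl
      rw [hρ, hq] at h2
      rw [h2, R.post_control hb (Or.inl hch.not_mem), hp ρ hch, add_zero, h1]
    · push Not at hlast
      rw [← hq]
      exact (R.final_eq_post fun ρ hρ => not_lt.2 (hlast ρ hρ)).symm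

/-- A flip on the edge `e` of the diagram may separate the ends of the segment `s` or change the
output `k`. -/
def Pays (R : C.Realizes T) (e : C.Edge) : Sg ⊕ Fin n → Prop
  | Sum.inl s => (∃ π' c, Charged T π' (s, c) ∧ e = Sum.inr (Sum.inl (R.gate π', false))) ∨
      (∃ c, e = Sum.inr (Sum.inr (R.gate (s, c)))) ∨
      (∃ c, e = Sum.inr (Sum.inl (R.gate (s, c), true))) ∨
      ∃ h : s ∉ S, e = Sum.inl (Sum.inr (R.seg ⟨s, h⟩))
  | Sum.inr k => e = Sum.inl (Sum.inl k)

theorem fst_eq_of_gate_eq {π π' : Sg × Bool} (h : R.gate π = R.gate π') : π.1 = π'.1 := by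
  rcases R.gate_inj _ _ h with rfl | h
  · rfl
  · exact h.2

/-- Control wires pay by `Charged.unique`; target wires, gate edges and final segment wires belong
to one segment, and final output wires to one output. No edge is therefore billed twice, which makes
the count of flips an upper bound. -/
theorem Pays.unique {e : C.Edge} {i j : Sg ⊕ Fin n} (hi : R.Pays e i) (hj : R.Pays e j) :
    i = j := by
  rcases i with s | k <;> rcases j with s' | k'
  · congr 1
    rcases hi with ⟨π, c, hc, rfl⟩ | ⟨c, rfl⟩ | ⟨c, rfl⟩ | ⟨h, rfl⟩ <;>
      rcases hj with ⟨π', c', hc', he⟩ | ⟨c', he⟩ | ⟨c', he⟩ | ⟨h', he⟩ <;>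
      simp only [Sum.inr.injEq, Sum.inl.injEq, Prod.mk.injEq, reduceCtorEq, and_true, and_false,
        Bool.false_eq_true, Bool.true_eq_false] at he
    · rcases R.gate_inj _ _ he with rfl | h
      · exact congrArg Prod.fst (hc.unique hc')
      · exact absurd h.1 hc.not_mem
    · exact R.fst_eq_of_gate_eq he
    · exact R.fst_eq_of_gate_eq he
    · exact congrArg Subtype.val (R.seg_injective he)
  · simp only [Pays] at hi hj
    subst hj
    simp at hi
  · simp only [Pays] at hi hj
    subst hi
    simp at hj
  · simp only [Pays] at hi hj
    rw [hi] at hj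
    simpa using hj

/-- Every solution assigns bits to the nodes so that every cut segment and every output that
deviates is paid for by a flipped edge. -/
theorem exists_node_bits [Fintype Sg] (hb : C.associatedDiagram.IsSol p x b) :
    ∃ β : V ⊕ M → ZMod 2,
      (Finset.univ.filter fun s => β (node (s, false)) ≠ β (node (s, true))).card +
        (Finset.univ.filter fun k => x k ≠ β (Sum.inr (R.mark.symm k))).card ≤
      (Finset.univ.filter fun e => p e ≠ 0).card := by
  classical
  obtain ⟨β, hv, hm⟩ := R.exists_node_values b
  refine ⟨β, ?_⟩
  rw [← Finset.card_disjSum]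
  -- Each cut segment or deviating output is paid for by some flipped edge, and no edge pays twice.
  refine Finset.card_le_card_of_forall_subsingleton (fun i e => R.Pays e i) ?_
    fun e _ i hi j hj => hi.2.unique R hj.2
  rintro (s | k) hi
  · simp only [Finset.inl_mem_disjSum, Finset.mem_filter, Finset.mem_univ, true_and] at hi
    by_contra! hno
    replace hno : ∀ e, R.Pays e (Sum.inl s) → p e = 0 := by
      intro e he
      by_contra hpe
      exact hno e (by simpa using hpe) he
    have hpost : ∀ c, R.post b (s, c) = β (node (s, c)) := fun c =>
      R.post_eq hb hv hm _ fun π' hπ' => hno _ (Or.inl ⟨π', c, hπ', rfl⟩)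
    apply hi
    rw [← hpost, ← hpost]
    by_cases hs : s ∈ S
    · exact R.post_direct hb hs (hno _ (Or.inr (Or.inr (Or.inl ⟨true, rfl⟩))))
        (hno _ (Or.inr (Or.inl ⟨true, rfl⟩)))
    · exact R.post_add_post hb ⟨s, hs⟩ (fun c => hno _ (Or.inr (Or.inr (Or.inl ⟨c, rfl⟩))))
        (fun c => hno _ (Or.inr (Or.inl ⟨c, rfl⟩))) (hno _ (Or.inr (Or.inr (Or.inr ⟨hs, rfl⟩))))
  · simp only [Finset.inr_mem_disjSum, Finset.mem_filter, Finset.mem_univ, true_and] at hi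
    refine ⟨Sum.inl (Sum.inl k), ?_, rfl⟩
    simp only [Finset.mem_filter, Finset.mem_univ, true_and]
    intro h0
    apply hi
    have := bitAt_output hb k
    rw [h0, add_zero] at this
    rw [this, ← hm, Equiv.apply_symm_apply]

end Solutions

/-- The number of gates before time `i` with target `w`. -/
def targetsBefore (C : CNOTCircuit n) (i : ℕ) (w : C.Qubit) : ℕ :=
  (Finset.univ.filter fun k : C.GateIdx => (k : ℕ) < i ∧ C.gateQubit (k, true) = w).card

theorem targetsBefore_succ (i : C.GateIdx) (w : C.Qubit) :
    targetsBefore C (i + 1) w =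
      targetsBefore C i w + if C.gateQubit (i, true) = w then 1 else 0 := by
  unfold targetsBefore
  split_ifs with h
  · rw [← Finset.card_insert_of_notMem (a := i) (by simp)]
    congr 1
    ext k
    simp only [Finset.mem_filter, Finset.mem_univ, true_and, Finset.mem_insert]
    constructor
    · rintro ⟨h1, h2⟩
      rcases Nat.lt_succ_iff_lt_or_eq.1 h1 with h1 | h1
      · exact Or.inr ⟨h1, h2⟩
      · exact Or.inl (Fin.ext h1)
    · rintro (rfl | ⟨h1, h2⟩)
      · exact ⟨Nat.lt_succ_self _, h⟩
      · exact ⟨h1.trans (Nat.lt_succ_self _), h2⟩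
  · rw [add_zero]
    congr 1
    ext k
    simp only [Finset.mem_filter, Finset.mem_univ, true_and]
    refine and_congr_left fun h2 => ⟨fun h1 => ?_, fun h1 => h1.trans (Nat.lt_succ_self _)⟩
    rcases Nat.lt_succ_iff_lt_or_eq.1 h1 with h1 | h1
    · exact h1
    · exact absurd (Fin.ext h1 ▸ h2) h

theorem targetsBefore_eq_zero {i : ℕ} {w : C.Qubit}
    (h : ∀ k : C.GateIdx, C.gateQubit (k, true) ≠ w) : targetsBefore C i w = 0 :=
  Finset.card_eq_zero.2 (Finset.filter_false_of_mem fun k _ hk => h k hk.2)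

theorem prep_node_of_forall {u : V ⊕ M} (h : ∀ s ∈ S, node (s, true) ≠ u) :
    C.prep (R.qubit u) = .X := by
  cases hp : C.prep (R.qubit u)
  · obtain ⟨s, hs, hu⟩ := (R.prep_node u).1 hp
    exact absurd hu (h s hs)
  · rfl

/-- Run the circuit with every `|+⟩` replaced by `1`. A node qubit prepared in `|0⟩` is set to `1`
by its unique direct gate, in the first layer and so before it ever acts as a control. Hence all
controls carry `1`, a qubit's bit is its initial bit plus the number of hits, and every segment
ancilla is hit twice and ends at `0`. -/
theorem exists_ones (R : C.Realizes T) : ∃ b, C.associatedDiagram.IsSol 0 1 b := by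
  have hone : ∀ i : C.GateIdx, ((if C.prep (C.gateQubit (i, false)) = .X then 1 else 0) +
      targetsBefore C i (C.gateQubit (i, false)) : ZMod 2) = 1 := by
    intro i
    obtain ⟨π, hπ, rfl⟩ := R.exists_control_port i
    rw [R.control π hπ]
    by_cases h : ∃ s ∈ S, node (s, true) = node π
    · obtain ⟨s, hs, hsn⟩ := h
      rw [if_neg (by rw [(R.prep_node _).2 ⟨s, hs, hsn⟩]; simp), zero_add]
      have hne : (s, true) ≠ π := by
        rintro rfl
        rcases hπ with h | h
        · exact h hs
        · simp at h
      have hlt : R.gate (s, true) < R.gate π := by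
        refine R.gate_lt _ _ hsn ?_
        have := T.layer_ne _ _ hsn hne
        rw [T.layer_direct s hs] at this ⊢
        exact Fin.pos_iff_ne_zero.2 this.symm
      have : targetsBefore C (R.gate π) (R.qubit (node π)) = 1 := by
        refine Finset.card_eq_one.2 ⟨R.gate (s, true), ?_⟩
        ext k
        simp only [Finset.mem_filter, Finset.mem_univ, true_and, Finset.mem_singleton]
        constructor
        · rintro ⟨-, hk⟩
          obtain ⟨s', hs', hsn', rfl⟩ := R.exists_of_target_node hk
          rw [eq_of_layer_eq (T := T) (hsn'.trans hsn.symm)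
            ((T.layer_direct s' hs' _).trans (T.layer_direct s hs _).symm)]
        · rintro rfl
          exact ⟨hlt, by rw [R.target_direct s hs, hsn]⟩
      rw [this, Nat.cast_one]
    · push Not at h
      rw [if_pos (R.prep_node_of_forall h), targetsBefore_eq_zero, Nat.cast_zero, add_zero]
      intro k hk
      obtain ⟨s, hs, hsn, -⟩ := R.exists_of_target_node hk
      exact h s hs hsn
  refine exists_isSol
    (σ := fun i w => (if C.prep w = .X then 1 else 0) + targetsBefore C i w) ?_ ?_ ?_ ?_ ?_ ?_
  · intro w hw
    rw [if_neg (by rw [hw]; simp), targetsBefore]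
    simp
  · intro i w h
    rw [targetsBefore_succ, if_neg (h true), add_zero]
  · intro i
    rw [targetsBefore_succ, if_neg (C.gateQubit_ne i).symm, add_zero]
  · intro i
    rw [hone i, targetsBefore_succ, if_pos rfl, Nat.cast_add, Nat.cast_one, add_assoc]
  · intro j hj
    rcases R.vert_or_seg j with ⟨v, rfl⟩ | ⟨s, rfl⟩
    · rw [R.meas_vert v] at hj
      simp at hj
    · rw [if_neg (by rw [R.prep_seg s]; simp), zero_add]
      have : targetsBefore C C.gates.length (Sum.inr (R.seg s)) = 2 := by
        rw [targetsBefore, ← Finset.card_pair (R.gate_seg_ne s)]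
        congr 1
        ext k
        simp only [Finset.mem_filter, Finset.mem_univ, true_and, Finset.mem_insert,
          Finset.mem_singleton]
        constructor
        · rintro ⟨-, hk⟩
          obtain ⟨c, rfl⟩ := R.exists_of_seg hk
          cases c
          · exact Or.inl rfl
          · exact Or.inr rfl
        · rintro (rfl | rfl) <;> exact ⟨Fin.is_lt _, R.target_seg s _⟩
      rw [this]; rfl
  · intro k
    have hq : R.qubit (Sum.inr (R.mark.symm k)) = Sum.inl k := by simp [qubit, nodeQubit]
    have hno : ∀ s ∈ S, node (s, true) ≠ Sum.inr (R.mark.symm k) := by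
      intro s hs h
      obtain ⟨v, hv⟩ := T.direct_vertex s hs true
      rw [hv] at h
      simp at h
    rw [← hq, if_pos (R.prep_node_of_forall hno), targetsBefore_eq_zero]
    · simp
    · intro j hj
      obtain ⟨s, hs, hsn, -⟩ := R.exists_of_target_node hj
      exact hno s hs hsn

end Realizes

end CNOTCircuit

/-! ### From robustness to fault tolerance -/

namespace MarkedGraph

variable (G : MarkedGraph)

/-- The two ends of a segment. -/
def portNode (π : G.Segment × Bool) : G.Node := if π.2 then G.segEnd π.1 else G.segStart π.1

variable {G}

/-- Cut the graph along the nodes with bit `1`. Robustness leaves at most as many marks as cut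
places on one side; an output that differs from the constant of the other side either deviates from
its mark or belongs to one of these few marks. The choice of side is the choice between `x` and `x +
1`. -/
theorem IsRobust.exists_flips {t n : ℕ} (hG : G.IsRobust t) (mark : G.Mark ≃ Fin n)
    (β : G.Node → ZMod 2) (x : Fin n → ZMod 2) {w : ℕ} (hw : w ≤ t)
    (h : (Finset.univ.filter fun s => β (G.portNode (s, false)) ≠ β (G.portNode (s, true))).card +
        (Finset.univ.filter fun k => x k ≠ β (Sum.inr (mark.symm k))).card ≤ w) :
    ∃ d : Fin n → ZMod 2, (x = d ∨ x = d + 1) ∧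
      (Finset.univ.filter fun k => d k ≠ 0).card ≤ w := by
  classical
  set A : Finset G.Node := Finset.univ.filter fun u => β u = 1
  have hmem : ∀ u, u ∈ A ↔ β u = 1 := fun u => by simp [A]
  have hcut : G.cutSize A =
      (Finset.univ.filter fun s => β (G.portNode (s, false)) ≠ β (G.portNode (s, true))).card := by
    unfold cutSize
    congr 1
    ext s
    simp only [Finset.mem_filter, Finset.mem_univ, true_and, hmem, portNode]
    have : ∀ a b : ZMod 2, (decide (a = 1) ≠ decide (b = 1)) ↔ a ≠ b := by decide
    exact this _ _
  have key : ∀ (B : Finset G.Node) (d : Fin n → ZMod 2), G.marksIn B ≤ G.cutSize A →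
      (∀ k, d k ≠ 0 → x k ≠ β (Sum.inr (mark.symm k)) ∨ (Sum.inr (mark.symm k) : G.Node) ∈ B) →
      (Finset.univ.filter fun k => d k ≠ 0).card ≤ w := by
    intro B d hB hd
    have hcard : (Finset.univ.filter fun k => (Sum.inr (mark.symm k) : G.Node) ∈ B).card =
        G.marksIn B := by
      unfold marksIn
      refine Finset.card_equiv mark.symm fun k => ?_
      simp
    calc (Finset.univ.filter fun k => d k ≠ 0).card
        ≤ ((Finset.univ.filter fun k => x k ≠ β (Sum.inr (mark.symm k))) ∪
            Finset.univ.filter fun k => (Sum.inr (mark.symm k) : G.Node) ∈ B).card := by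
          refine Finset.card_le_card fun k hk => ?_
          simp only [Finset.mem_filter, Finset.mem_univ, true_and, Finset.mem_union] at hk ⊢
          exact hd k hk
      _ ≤ _ := Finset.card_union_le _ _
      _ ≤ w := by omega
  rcases hG A (by omega) with hA | hA
  · refine ⟨x, Or.inl rfl, key A x hA fun k hk => ?_⟩
    rw [hmem]
    have : ∀ a b : ZMod 2, a ≠ 0 → a ≠ b ∨ b = 1 := by decide
    exact this _ _ hk
  · refine ⟨x + 1, Or.inr ?_, key Aᶜ _ hA fun k hk => ?_⟩
    · rw [add_assoc, ZXDiagram.add_self_bits, add_zero]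
    · rw [Finset.mem_compl, hmem]
      have : ∀ a b : ZMod 2, a + 1 ≠ 0 → a ≠ b ∨ b ≠ 1 := by decide
      exact this _ _ hk

/-- A circuit that realizes a robust marked graph prepares the CAT state fault-tolerantly. -/
theorem IsRobust.ftPreparesCat {t n : ℕ} (hG : G.IsRobust t) (hn : 0 < n) {C : CNOTCircuit n}
    {S : Finset G.Segment} {T : PortSchedule G.portNode S} (R : C.Realizes T) :
    C.associatedDiagram.FTPreparesCat t := by
  have hcat : C.associatedDiagram.IsCatLike fun k => (Sum.inl (Sum.inl k) : C.Edge) :=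
    { phase_eq := fun _ => rfl
      out_injective := fun k k' h => Sum.inl_injective (Sum.inl_injective h)
      attach_out := fun _ => rfl
      exists_ones := R.exists_ones
      -- Without flips the bounds hold with weight zero, so `d = 0` and the outputs are constant.
      const := fun x b hb => by
        obtain ⟨β, hβ⟩ := R.exists_node_bits hb
        have h0 : (Finset.univ.filter fun e : C.Edge => (0 : C.Edge → ZMod 2) e ≠ 0).card = 0 := by
          simp
        obtain ⟨d, hd, hd0⟩ := hG.exists_flips R.mark β x (Nat.zero_le t)
          (hβ.trans h0.le)
        have : d = 0 := by
          funext k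
          by_contra hk
          exact absurd (Finset.card_eq_zero.1 (Nat.le_zero.1 hd0))
            (Finset.Nonempty.ne_empty ⟨k, by simpa using hk⟩)
        rw [this, zero_add] at hd
        exact hd }
  refine hcat.ftPreparesCat hn t fun p x b hb hp => ?_
  obtain ⟨β, hβ⟩ := R.exists_node_bits hb
  exact hG.exists_flips R.mark β x hp hβ

end MarkedGraph

/-! ### Two-colouring the union of two matchings -/

theorem exists_partner {X A : Type*} (f : X → A)
    (hf : ∀ x y z, f x = f y → f x = f z → x = y ∨ x = z ∨ y = z) :
    ∃ α : X → X, Function.Involutive α ∧ ∀ x y, x ≠ y → f x = f y → α x = y := by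
  classical
  let α : X → X := fun x => if h : ∃ y, y ≠ x ∧ f y = f x then h.choose else x
  have hα : ∀ x y, x ≠ y → f x = f y → α x = y := by
    intro x y hxy hfxy
    have h : ∃ y, y ≠ x ∧ f y = f x := ⟨y, hxy.symm, hfxy.symm⟩
    have h1 : α x = h.choose := dif_pos h
    have h2 := h.choose_spec
    rw [h1]
    rcases hf x y _ hfxy h2.2.symm with h' | h' | h'
    · exact absurd h' hxy
    · exact absurd h'.symm h2.1
    · exact h'.symm
  refine ⟨α, fun x => ?_, hα⟩
  by_cases h : ∃ y, y ≠ x ∧ f y = f x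
  · obtain ⟨y, hy, hfy⟩ := h
    rw [hα x y hy.symm hfy.symm, hα y x hy hfy]
  · have : α x = x := dif_neg h
    rw [this, this]

/-- The graph with edges `{x, α x}` and `{x, β x}` is a union of even cycles and two-way infinite
paths. With `ρ = αβ`, each component splits into two `ρ`-orbits, which both `α` and `β` exchange;
these orbits are the colour classes. -/
theorem exists_two_coloring_of_fixedPointFree {X : Type*} {α β : X → X}
    (hα : Function.Involutive α) (hβ : Function.Involutive β) (hα' : ∀ x, α x ≠ x)
    (hβ' : ∀ x, β x ≠ x) : ∃ c : X → Bool, ∀ x, c (α x) ≠ c x ∧ c (β x) ≠ c x := by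
  classical
  set a : Equiv.Perm X := hα.toPerm
  set b : Equiv.Perm X := hβ.toPerm
  have haa : a⁻¹ = a := by ext x; exact Equiv.symm_apply_eq _ |>.2 (hα x).symm
  have hbb : b⁻¹ = b := by ext x; exact Equiv.symm_apply_eq _ |>.2 (hβ x).symm
  set ρ : Equiv.Perm X := a * b with hρ
  have hinv : a * ρ * a⁻¹ = ρ⁻¹ := by
    rw [hρ, mul_inv_rev, haa, hbb, ← mul_assoc]
    nth_rw 1 [← haa]
    rw [inv_mul_cancel, one_mul]
  have hconj : ∀ (k : ℤ) (x : X), (ρ ^ (-k)) (α x) = α ((ρ ^ k) x) := by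
    intro k x
    have : a * ρ ^ k * a⁻¹ = ρ ^ (-k) := by rw [← conj_zpow, hinv, inv_zpow, zpow_neg]
    rw [← this, haa]
    change α ((ρ ^ k) (α (α x))) = _
    rw [hα x]
  have hsame : ∀ x y, ρ.SameCycle x y → ρ.SameCycle (α x) (α y) := by
    rintro x y ⟨k, rfl⟩
    exact ⟨-k, hconj k x⟩
  have hne : ∀ x, ¬ρ.SameCycle x (α x) := by
    rintro x ⟨k, hk⟩
    -- Since `α` conjugates `ρ` to its inverse, `ρ ^ k x = α x` makes `ρ ^ m x` a fixed point of `α`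
    -- when `k = 2m`, and of `β` when `k = 2m + 1`.
    obtain ⟨m, rfl | rfl⟩ := Int.even_or_odd' k
    · apply hα' ((ρ ^ m) x)
      rw [← hconj, ← hk, ← Equiv.Perm.mul_apply, ← zpow_add]
      congr 2; ring
    · apply hβ' ((ρ ^ m) x)
      apply hα.injective
      change ρ ((ρ ^ m) x) = _
      rw [← hconj, ← hk, ← Equiv.Perm.mul_apply, ← Equiv.Perm.mul_apply, ← zpow_add,
        ← zpow_one_add]
      congr 2; ring
  let q : X → Quotient (Equiv.Perm.SameCycle.setoid ρ) := Quotient.mk _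
  have hq : ∀ x y, ρ.SameCycle x y → q x = q y := fun x y h => Quotient.sound h
  have hq' : ∀ x, q x ≠ q (α x) := fun x h => hne x (Quotient.exact h)
  have hβα : ∀ x, q (β x) = q (α x) := fun x => hq _ _ ⟨1, by
    rw [zpow_one]
    change α (β (β x)) = _
    rw [hβ x]⟩
  have hαβ : ∀ x, q (α (β x)) = q x := fun x => (hq _ _ ⟨1, by rw [zpow_one]; rfl⟩).symm
  have hflip : ∀ A B : Quotient (Equiv.Perm.SameCycle.setoid ρ), A ≠ B →
      decide (WellOrderingRel B A) ≠ decide (WellOrderingRel A B) := by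
    intro A B hAB
    rcases trichotomous_of WellOrderingRel A B with h | h | h
    · simp [h, asymm_of WellOrderingRel h]
    · exact absurd h hAB
    · simp [h, asymm_of WellOrderingRel h]
  -- A well-order on orbits selects one of the two orbits of each component.
  refine ⟨fun x => decide (WellOrderingRel (q x) (q (α x))), fun x => ⟨?_, ?_⟩⟩
  · simp only [hα x]
    exact hflip _ _ (hq' x)
  · simp only [hβα, hαβ]
    exact hflip _ _ (hq' x)

/-- Unmatched points are matched with their own second copy, which removes fixed points without
changing the matched pairs in the first copy. -/
theorem exists_fixedPointFree_double {X : Type*} {α : X → X} (hα : Function.Involutive α) :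
    ∃ α' : X × Bool → X × Bool, Function.Involutive α' ∧ (∀ x, α' x ≠ x) ∧
      ∀ x, α x ≠ x → α' (x, false) = (α x, false) := by
  classical
  refine ⟨fun x => if α x.1 = x.1 then (x.1, !x.2) else (α x.1, x.2), ?_, ?_, ?_⟩
  · rintro ⟨x, c⟩
    by_cases h : α x = x
    · simp [h]
    · simp only [if_neg h, hα x, if_neg (Ne.symm h)]
  · rintro ⟨x, c⟩ hx
    by_cases h : α x = x
    · simp [h] at hx
    · simp [h] at hx
  · intro x h
    simp [h]

/-- If two maps have fibres of at most two elements, the points can be coloured with two colours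
so that no fibre is monochromatic. -/
theorem exists_two_coloring {X A B : Type*} (f : X → A) (g : X → B)
    (hf : ∀ x y z, f x = f y → f x = f z → x = y ∨ x = z ∨ y = z)
    (hg : ∀ x y z, g x = g y → g x = g z → x = y ∨ x = z ∨ y = z) :
    ∃ c : X → Bool, ∀ x y, x ≠ y → (f x = f y ∨ g x = g y) → c x ≠ c y := by
  obtain ⟨α, hα, hαf⟩ := exists_partner f hf
  obtain ⟨β, hβ, hβg⟩ := exists_partner g hg
  obtain ⟨α', hα', hαfix, hαα⟩ := exists_fixedPointFree_double hα
  obtain ⟨β', hβ', hβfix, hββ⟩ := exists_fixedPointFree_double hβ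
  obtain ⟨c, hc⟩ := exists_two_coloring_of_fixedPointFree hα' hβ' hαfix hβfix
  refine ⟨fun x => c (x, false), ?_⟩
  rintro x y hxy (h | h)
  · have hy := hαf x y hxy h
    have := (hc (x, false)).1
    rw [hαα x (by rw [hy]; exact hxy.symm), hy] at this
    exact this.symm
  · have hy := hβg x y hxy h
    have := (hc (x, false)).2
    rw [hββ x (by rw [hy]; exact hxy.symm), hy] at this
    exact this.symm

/-! ### Schedules -/

/-- Every vertex has three ports and every mark two. -/
structure IsCubic {V M Sg : Type} [Fintype Sg] [DecidableEq V] [DecidableEq M]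
    (node : Sg × Bool → V ⊕ M) : Prop where
  vertex : ∀ v, (Finset.univ.filter fun π => node π = Sum.inl v).card = 3
  mark : ∀ m, (Finset.univ.filter fun π => node π = Sum.inr m).card = 2

/-- The segments in `S` join distinct vertices and are pairwise disjoint. -/
structure IsDirectMatching {V M Sg : Type} (node : Sg × Bool → V ⊕ M) (S : Finset Sg) : Prop where
  vertex : ∀ s ∈ S, ∀ c, ∃ v, node (s, c) = Sum.inl v
  injective : ∀ π π' : Sg × Bool, π.1 ∈ S → π'.1 ∈ S → node π = node π' → π = π'

/-- Ports in the three layers, in this order, such that consecutive ones share a qubit. -/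
def PortSchedule.HasChain {V M Sg : Type} {node : Sg × Bool → V ⊕ M} {S : Finset Sg}
    (T : PortSchedule node S) : Prop :=
  ∃ π₁ π₂ π₃ : Sg × Bool, T.layer π₁ = 0 ∧ T.layer π₂ = 1 ∧ T.layer π₃ = 2 ∧
    (node π₁ = node π₂ ∨ π₁.1 ∉ S ∧ π₁.1 = π₂.1) ∧ node π₂ = node π₃

theorem PortSchedule.hasChain_of_vertex {V M Sg : Type} {node : Sg × Bool → V ⊕ M}
    {S : Finset Sg} (T : PortSchedule node S) (v : V) : T.HasChain := by
  obtain ⟨π₁, h₁, hl₁⟩ := T.exists_layer v 0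
  obtain ⟨π₂, h₂, hl₂⟩ := T.exists_layer v 1
  obtain ⟨π₃, h₃, hl₃⟩ := T.exists_layer v 2
  exact ⟨π₁, π₂, π₃, hl₁, hl₂, hl₃, Or.inl (h₁.trans h₂.symm), h₂.trans h₃.symm⟩

section Schedules

variable {V M Sg : Type} [Fintype Sg] [DecidableEq V] [DecidableEq M] {node : Sg × Bool → V ⊕ M}
  {S : Finset Sg}

theorem fst_fiber {Y : Type*} (x y z : Y × Bool) (h : x.1 = y.1) (h' : x.1 = z.1) :
    x = y ∨ x = z ∨ y = z := by
  obtain ⟨a, x⟩ := x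
  obtain ⟨b, y⟩ := y
  obtain ⟨c, z⟩ := z
  simp only at h h'
  subst h
  subst h'
  revert x y z
  simp

theorem IsCubic.mark_ports (h : IsCubic node) (m : M) :
    ∃ π π', π ≠ π' ∧ ∀ ρ, node ρ = Sum.inr m ↔ ρ = π ∨ ρ = π' := by
  classical
  obtain ⟨π, π', hne, hπ⟩ := Finset.card_eq_two.1 (h.mark m)
  refine ⟨π, π', hne, fun ρ => ?_⟩
  have : ρ ∈ Finset.univ.filter (fun π => node π = Sum.inr m) ↔ ρ = π ∨ ρ = π' := by
    rw [hπ]; simp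
  simpa using this

/-- Hall's condition holds because `k` vertices have `3k` ports, while a segment has only two, so at
least `3k/2` segments meet them. -/
theorem IsCubic.exists_distinct_segments (h : IsCubic node) (U : Set V) :
    ∃ port : U → Sg × Bool, (∀ v, node (port v) = Sum.inl v.1) ∧
      Function.Injective fun v => (port v).1 := by
  classical
  let t : U → Finset Sg := fun v =>
    (Finset.univ.filter fun π => node π = Sum.inl v.1).image Prod.fst
  obtain ⟨f, hf, hft⟩ := (Finset.all_card_le_biUnion_card_iff_exists_injective t).1 (by
    intro s
    have h1 : s.card * 3 = (s.biUnion fun v =>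
        Finset.univ.filter fun π => node π = Sum.inl v.1).card := by
      rw [Finset.card_biUnion, Finset.sum_const_nat fun v _ => h.vertex v.1]
      intro v _ v' _ hne
      rw [Function.onFun, Finset.disjoint_left]
      intro π hπ hπ'
      simp only [Finset.mem_filter, Finset.mem_univ, true_and] at hπ hπ'
      rw [hπ] at hπ'
      exact hne (Subtype.ext (Sum.inl_injective hπ'))
    have h2 : (s.biUnion fun v => Finset.univ.filter fun π => node π = Sum.inl v.1) ⊆
        (s.biUnion t) ×ˢ (Finset.univ : Finset Bool) := by
      intro π hπ
      simp only [Finset.mem_biUnion, Finset.mem_filter, Finset.mem_univ, true_and] at hπ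
      obtain ⟨v, hv, hπ⟩ := hπ
      simp only [Finset.mem_product, Finset.mem_univ, and_true, Finset.mem_biUnion]
      exact ⟨v, hv, Finset.mem_image_of_mem _ (by simpa using hπ)⟩
    have h3 := Finset.card_le_card h2
    rw [Finset.card_product, Finset.card_univ, Fintype.card_bool] at h3
    omega)
  have : ∀ v, ∃ π, node π = Sum.inl v.1 ∧ π.1 = f v := by
    intro v
    obtain ⟨π, hπ, hπf⟩ := Finset.mem_image.1 (hft v)
    exact ⟨π, by simpa using hπ, hπf⟩
  choose port hp hpf using this
  exact ⟨port, hp, fun v v' hv => hf (by rw [← hpf, ← hpf]; exact hv)⟩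

/-- The first layer takes exactly one port at each vertex, either its direct port or one supplied by
Hall's theorem. What remains has at most two ports at each node and at each segment, so two colours
suffice for the other layers. -/
theorem IsCubic.exists_schedule (h : IsCubic node) (hS : IsDirectMatching node S) :
    Nonempty (PortSchedule node S) := by
  classical
  -- Only the vertices missed by the matching need a port from Hall's theorem; such a port
  -- automatically lies outside `S`.
  let U : Set V := {v | ∀ π : Sg × Bool, π.1 ∈ S → node π ≠ Sum.inl v}
  obtain ⟨port, hport, hinj⟩ := h.exists_distinct_segments U
  let Q : Sg × Bool → Prop := fun π => π.1 ∈ S ∨ ∃ v, port v = π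
  have hQ : ∀ v : V, ∃ π, node π = Sum.inl v ∧ Q π := by
    intro v
    by_cases hv : v ∈ U
    · exact ⟨port ⟨v, hv⟩, hport _, Or.inr ⟨_, rfl⟩⟩
    · simp only [U, Set.mem_ofPred_eq, not_forall, not_not] at hv
      obtain ⟨π, hπ, hn⟩ := hv
      exact ⟨π, hn, Or.inl hπ⟩
  obtain ⟨c, hc⟩ := exists_two_coloring (X := {π // ¬Q π}) (fun π => node π.1) (fun π => π.1.1)
    (by
      intro x y z hxy hxz
      by_contra! hne
      have hsub : ∀ u, node x.1 = u → ({x.1, y.1, z.1} : Finset (Sg × Bool)) ⊆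
          Finset.univ.filter fun π => node π = u := by
        intro u hu π hπ
        simp only [Finset.mem_insert, Finset.mem_singleton] at hπ
        simp only [Finset.mem_filter, Finset.mem_univ, true_and]
        rcases hπ with rfl | rfl | rfl
        · exact hu
        · exact hxy.symm.trans hu
        · exact hxz.symm.trans hu
      have hcard : ({x.1, y.1, z.1} : Finset (Sg × Bool)).card = 3 :=
        Finset.card_eq_three.2 ⟨_, _, _, fun h => hne.1 (Subtype.ext h),
          fun h => hne.2.1 (Subtype.ext h), fun h => hne.2.2 (Subtype.ext h), rfl⟩
      cases hu : node x.1 with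
      | inl v =>
        obtain ⟨π, hπ, hπQ⟩ := hQ v
        have heq := Finset.eq_of_subset_of_card_le (hsub _ hu) (by rw [hcard, h.vertex v])
        have hmem : π ∈ ({x.1, y.1, z.1} : Finset (Sg × Bool)) := by rw [heq]; simpa using hπ
        simp only [Finset.mem_insert, Finset.mem_singleton] at hmem
        rcases hmem with rfl | rfl | rfl
        · exact x.2 hπQ
        · exact y.2 hπQ
        · exact z.2 hπQ
      | inr m =>
        have := Finset.card_le_card (hsub _ hu)
        rw [hcard, h.mark m] at this
        omega)
    (fun x y z hxy hxz => by
      simpa only [Subtype.ext_iff] using fst_fiber x.1 y.1 z.1 hxy hxz)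
  let layer : Sg × Bool → Fin 3 := fun π => if hπ : Q π then 0 else if c ⟨π, hπ⟩ then 1 else 2
  have hlayer : ∀ π π', π ≠ π' → (node π = node π' ∨ π.1 = π'.1) → ¬(Q π ∧ Q π') →
      layer π ≠ layer π' := by
    intro π π' hne hor hnot
    by_cases h1 : Q π <;> by_cases h2 : Q π'
    · exact absurd ⟨h1, h2⟩ hnot
    · simp only [layer, dif_pos h1, dif_neg h2]
      split_ifs <;> decide
    · simp only [layer, dif_neg h1, dif_pos h2]
      split_ifs <;> decide
    · have := hc ⟨π, h1⟩ ⟨π', h2⟩ (fun h => hne (congrArg Subtype.val h)) hor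
      simp only [layer, dif_neg h1, dif_neg h2]
      cases ha : c ⟨π, h1⟩ <;> cases hb : c ⟨π', h2⟩ <;> simp_all
  have hne : ∀ π π', node π = node π' → π ≠ π' → layer π ≠ layer π' := by
    intro π π' hn hne
    refine hlayer π π' hne (Or.inl hn) ?_
    rintro ⟨h1 | ⟨v, rfl⟩, h2 | ⟨v', rfl⟩⟩
    · exact hne (hS.injective _ _ h1 h2 hn)
    · exact v'.2 π h1 (hn.trans (hport v'))
    · exact v.2 π' h2 (hn.symm.trans (hport v))
    · rw [hport, hport] at hn
      exact hne (by rw [Subtype.ext (Sum.inl_injective hn)])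
  refine ⟨⟨layer, hne, ?_, fun s hs c => dif_pos (Or.inl hs), hS.vertex, ?_, fun m => ?_⟩⟩
  · intro s hs
    refine hlayer _ _ (by simp) (Or.inr rfl) ?_
    rintro ⟨h1 | ⟨v, hv⟩, h2 | ⟨v', hv'⟩⟩
    · exact hs h1
    · exact hs h1
    · exact hs h2
    · have : v = v' := hinj (by simp only [hv, hv'])
      rw [this, hv'] at hv
      simp at hv
  · intro v l
    have : (Finset.univ.filter fun π => node π = Sum.inl v).image layer = Finset.univ := by
      rw [← Finset.card_eq_iff_eq_univ, Finset.card_image_of_injOn, h.vertex v, Fintype.card_fin]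
      intro π hπ π' hπ' hl
      by_contra hpp
      simp only [Finset.coe_filter, Finset.mem_univ, true_and, Set.mem_ofPred_eq] at hπ hπ'
      exact hne π π' (hπ.trans hπ'.symm) hpp hl
    obtain ⟨π, hπ, hl⟩ := Finset.mem_image.1 (this ▸ Finset.mem_univ l)
    exact ⟨π, by simpa using hπ, hl⟩
  · obtain ⟨π, π', -, hπ⟩ := h.mark_ports m
    exact ⟨π, π', fun ρ hρ => (hπ ρ).1 hρ⟩

/-- Without vertices the two colours alone give a valid schedule with two layers. One port is moved
to an extra earlier layer so that the depth is exactly three. -/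
theorem IsCubic.exists_schedule_of_isEmpty [IsEmpty V] (h : IsCubic node) {s : Sg}
    (hs : node (s, false) ≠ node (s, true)) : ∃ T : PortSchedule node ∅, T.HasChain := by
  classical
  have hmark : ∀ π, ∃ m, node π = Sum.inr m := by
    intro π
    cases hn : node π with
    | inl v => exact isEmptyElim v
    | inr m => exact ⟨m, rfl⟩
  obtain ⟨c, hc⟩ := exists_two_coloring node Prod.fst (fun x y z hxy hxz => by
      obtain ⟨m, hm⟩ := hmark x
      obtain ⟨π, π', -, hπ⟩ := h.mark_ports m
      have hx := (hπ x).1 hm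
      have hy := (hπ y).1 (hxy.symm.trans hm)
      have hz := (hπ z).1 (hxz.symm.trans hm)
      rcases hx with rfl | rfl <;> rcases hy with rfl | rfl <;> rcases hz with rfl | rfl <;> simp)
    fst_fiber
  obtain ⟨d, hd, hd'⟩ : ∃ d, c (s, d) = true ∧ c (s, !d) = false := by
    have := hc (s, false) (s, true) (by simp) (Or.inr rfl)
    cases h0 : c (s, false) <;> cases h1 : c (s, true)
    · exact absurd (h0.trans h1.symm) this
    · exact ⟨true, h1, h0⟩
    · exact ⟨false, h0, h1⟩
    · exact absurd (h0.trans h1.symm) this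
  have hsd : node (s, d) ≠ node (s, !d) := by
    cases d
    · exact hs
    · exact hs.symm
  -- The moved port `(s, d)` had the colour of the last layer. The chain is `(s, d)`, then `(s, !d)`
  -- on the same segment, then the other port at the mark of `(s, !d)`, which is not `(s, d)`
  -- because the ends of `s` differ.
  let layer : Sg × Bool → Fin 3 := fun π => if π = (s, d) then 0 else if c π then 2 else 1
  have hlayer : ∀ π π', π ≠ π' → (node π = node π' ∨ π.1 = π'.1) → layer π ≠ layer π' := by
    intro π π' hne hor
    have hcc := hc π π' hne hor
    by_cases h1 : π = (s, d) <;> by_cases h2 : π' = (s, d)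
    · exact absurd (h1.trans h2.symm) hne
    · simp only [layer, if_pos h1, if_neg h2]
      split_ifs <;> decide
    · simp only [layer, if_neg h1, if_pos h2]
      split_ifs <;> decide
    · simp only [layer, if_neg h1, if_neg h2]
      cases ha : c π <;> cases hb : c π' <;> simp_all
  obtain ⟨m, hm⟩ := hmark (s, !d)
  obtain ⟨ρ, hρ, hρn⟩ : ∃ ρ, ρ ≠ (s, !d) ∧ node (s, !d) = node ρ := by
    obtain ⟨π, π', hne, hπ⟩ := h.mark_ports m
    rcases (hπ _).1 hm with h1 | h1
    · exact ⟨π', h1 ▸ hne.symm, hm.trans ((hπ π').2 (Or.inr rfl)).symm⟩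
    · exact ⟨π, h1 ▸ hne, hm.trans ((hπ π).2 (Or.inl rfl)).symm⟩
  refine ⟨⟨layer, fun π π' hn hne => hlayer π π' hne (Or.inl hn),
    fun s _ => hlayer _ _ (by simp) (Or.inr rfl), fun s hs => absurd hs (Finset.notMem_empty s),
    fun s hs => absurd hs (Finset.notMem_empty s), fun v => isEmptyElim v, fun m => ?_⟩,
    (s, d), (s, !d), ρ, if_pos rfl, ?_, ?_, Or.inr ⟨Finset.notMem_empty _, rfl⟩, hρn⟩
  · obtain ⟨π, π', -, hπ⟩ := h.mark_ports m
    exact ⟨π, π', fun ρ hρ => (hπ ρ).1 hρ⟩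
  · simp only [layer]
    rw [if_neg (by simp), hd']
    simp
  · simp only [layer]
    have h1 : ρ ≠ (s, d) := fun h => hsd (by rw [hρn, h])
    have h2 : c ρ = true := by
      have := hc _ _ hρ (Or.inl hρn.symm)
      rw [hd'] at this
      simpa using this
    rw [if_neg h1, if_pos h2]

end Schedules

theorem isDirectMatching_empty {V M Sg : Type} {node : Sg × Bool → V ⊕ M} :
    IsDirectMatching node ∅ :=
  ⟨fun s hs => absurd hs (Finset.notMem_empty s), fun π _ h => absurd h (Finset.notMem_empty π.1)⟩

/-! ### Port counts and a large matching of links -/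

section Matching

variable {V M Sg : Type} [Fintype Sg] [DecidableEq V] [DecidableEq M] {node : Sg × Bool → V ⊕ M}

theorem IsCubic.card_fiber_le (h : IsCubic node) (u : V ⊕ M) :
    (Finset.univ.filter fun π => node π = u).card ≤ 3 := by
  cases u with
  | inl v => exact (h.vertex v).le
  | inr m => rw [h.mark m]; omega

theorem IsCubic.card_vertex_ports [Fintype V] (h : IsCubic node) :
    (Finset.univ.filter fun π => ∃ v, node π = Sum.inl v).card = 3 * Fintype.card V := by
  classical
  have : (Finset.univ.filter fun π => ∃ v, node π = Sum.inl v) =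
      Finset.univ.biUnion fun v => Finset.univ.filter fun π => node π = Sum.inl v := by
    ext π; simp
  rw [this, Finset.card_biUnion, Finset.sum_const_nat fun v _ => h.vertex v, Finset.card_univ,
    mul_comm]
  intro v _ v' _ hne
  rw [Function.onFun, Finset.disjoint_left]
  intro π hπ hπ'
  simp only [Finset.mem_filter, Finset.mem_univ, true_and] at hπ hπ'
  exact hne (Sum.inl_injective (hπ.symm.trans hπ'))

theorem IsCubic.card_mark_ports [Fintype M] (h : IsCubic node) :
    (Finset.univ.filter fun π => ∃ m, node π = Sum.inr m).card = 2 * Fintype.card M := by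
  classical
  have : (Finset.univ.filter fun π => ∃ m, node π = Sum.inr m) =
      Finset.univ.biUnion fun m => Finset.univ.filter fun π => node π = Sum.inr m := by
    ext π; simp
  rw [this, Finset.card_biUnion, Finset.sum_const_nat fun v _ => h.mark v, Finset.card_univ,
    mul_comm]
  intro v _ v' _ hne
  rw [Function.onFun, Finset.disjoint_left]
  intro π hπ hπ'
  simp only [Finset.mem_filter, Finset.mem_univ, true_and] at hπ hπ'
  exact hne (Sum.inr_injective (hπ.symm.trans hπ'))

theorem IsCubic.two_mul_card_segments [Fintype V] [Fintype M] (h : IsCubic node) :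
    2 * Fintype.card Sg = 3 * Fintype.card V + 2 * Fintype.card M := by
  classical
  rw [← h.card_vertex_ports, ← h.card_mark_ports, ← Finset.card_union_of_disjoint]
  · have : (Finset.univ.filter fun π => ∃ v, node π = Sum.inl v) ∪
        (Finset.univ.filter fun π => ∃ m, node π = Sum.inr m) = Finset.univ := by
      ext π
      cases hn : node π <;> simp [hn]
    rw [this, Finset.card_univ, Fintype.card_prod, Fintype.card_bool, mul_comm]
  · rw [Finset.disjoint_left]
    intro π hπ hπ'
    simp only [Finset.mem_filter, Finset.mem_univ, true_and] at hπ hπ'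
    obtain ⟨v, hv⟩ := hπ
    obtain ⟨m, hm⟩ := hπ'
    rw [hv] at hm
    simp at hm

/-- The segments that join two distinct vertices. -/
def IsLink (node : Sg × Bool → V ⊕ M) (s : Sg) : Prop :=
  (∀ c, ∃ v, node (s, c) = Sum.inl v) ∧ node (s, false) ≠ node (s, true)

/-- The segments that join a vertex to itself. -/
def IsSelfLoop (node : Sg × Bool → V ⊕ M) (s : Sg) : Prop :=
  (∃ v, node (s, false) = Sum.inl v) ∧ node (s, false) = node (s, true)

/-- Two self-loops at one vertex would use four of its three ports. -/
theorem IsCubic.card_selfLoops_le [Fintype V] [DecidablePred (IsSelfLoop node)]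
    (h : IsCubic node) :
    (Finset.univ.filter fun s => IsSelfLoop node s).card ≤ Fintype.card V := by
  classical
  have : ((Finset.univ.filter fun s => IsSelfLoop node s).image fun s => node (s, false)).card ≤
      ((Finset.univ : Finset V).image (Sum.inl : V → V ⊕ M)).card := by
    refine Finset.card_le_card fun u hu => ?_
    obtain ⟨s, hs, rfl⟩ := Finset.mem_image.1 hu
    obtain ⟨v, hv⟩ := (Finset.mem_filter.1 hs).2.1
    rw [hv]
    exact Finset.mem_image_of_mem _ (Finset.mem_univ v)
  rw [Finset.card_image_of_injective _ Sum.inl_injective, Finset.card_univ,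
    Finset.card_image_of_injOn] at this
  · exact this
  intro s hs s' hs' hss
  by_contra hne
  simp only [Finset.coe_filter, Finset.mem_univ, true_and, Set.mem_ofPred_eq] at hs hs' hss
  have hsub : ({s, s'} : Finset Sg) ×ˢ (Finset.univ : Finset Bool) ⊆
      Finset.univ.filter fun π => node π = node (s, false) := by
    rintro ⟨a, c⟩ hπ
    simp only [Finset.mem_product, Finset.mem_insert, Finset.mem_singleton, Finset.mem_univ,
      and_true] at hπ
    simp only [Finset.mem_filter, Finset.mem_univ, true_and]
    rcases hπ with rfl | rfl <;> cases c
    · rfl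
    · exact hs.2.symm
    · exact hss.symm
    · exact hs'.2.symm.trans hss.symm
  have h1 := (Finset.card_le_card hsub).trans (h.card_fiber_le _)
  rw [Finset.card_product, Finset.card_pair hne, Finset.card_univ, Fintype.card_bool] at h1
  omega

/-- Each of the `3|V|` vertex ports lies on a link, on a self-loop, or opposite a mark port. The
self-loops account for at most `2|V|` ports and the mark ports for at most `2|M|`. -/
theorem IsCubic.card_vertices_le [Fintype V] [Fintype M] [DecidablePred (IsLink node)]
    (h : IsCubic node) : Fintype.card V ≤
      2 * (Finset.univ.filter fun s => IsLink node s).card + 2 * Fintype.card M := by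
  classical
  have hsub : (Finset.univ.filter fun π => ∃ v, node π = Sum.inl v) ⊆
      ((Finset.univ.filter fun s => IsLink node s) ×ˢ (Finset.univ : Finset Bool) ∪
        (Finset.univ.filter fun s => IsSelfLoop node s) ×ˢ (Finset.univ : Finset Bool)) ∪
      (Finset.univ.filter fun π => ∃ m, node π = Sum.inr m).image fun π => (π.1, !π.2) := by
    rintro ⟨s, c⟩ hπ
    simp only [Finset.mem_filter, Finset.mem_univ, true_and] at hπ
    obtain ⟨v, hv⟩ := hπ
    cases hn : node (s, !c) with
    | inr m =>
      refine Finset.mem_union_right _ (Finset.mem_image.2 ⟨(s, !c), ?_, by simp⟩)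
      simp [hn]
    | inl v' =>
      refine Finset.mem_union_left _ ?_
      have hall : ∀ d, ∃ v, node (s, d) = Sum.inl v := by
        intro d
        by_cases hd : d = c
        · exact ⟨v, by rw [hd, hv]⟩
        · have : d = !c := by cases d <;> cases c <;> simp_all
          exact ⟨v', by rw [this, hn]⟩
      by_cases heq : node (s, false) = node (s, true)
      · exact Finset.mem_union_right _ (by
          simp only [Finset.mem_product, Finset.mem_filter, Finset.mem_univ, true_and, and_true]
          exact ⟨hall false, heq⟩)
      · exact Finset.mem_union_left _ (by
          simp only [Finset.mem_product, Finset.mem_filter, Finset.mem_univ, true_and, and_true]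
          exact ⟨hall, heq⟩)
  have h1 := Finset.card_le_card hsub
  have h2 := h1.trans ((Finset.card_union_le _ _).trans
    (add_le_add (Finset.card_union_le _ _) Finset.card_image_le))
  rw [h.card_vertex_ports, h.card_mark_ports, Finset.card_product, Finset.card_product,
    Finset.card_univ, Fintype.card_bool] at h2
  have h3 := h.card_selfLoops_le
  omega

/-- There is a large set of pairwise disjoint links. -/
theorem IsCubic.exists_directMatching [Fintype V] [Fintype M] (h : IsCubic node) :
    ∃ S : Finset Sg, IsDirectMatching node S ∧
      Fintype.card V ≤ 10 * S.card + 2 * Fintype.card M := by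
  classical
  obtain ⟨S, hS, hmax⟩ := Finset.exists_max_image
    (Finset.univ.filter fun S : Finset Sg => IsDirectMatching node S) Finset.card
    ⟨∅, by simpa using isDirectMatching_empty⟩
  replace hS : IsDirectMatching node S := by simpa using hS
  refine ⟨S, hS, ?_⟩
  set B : Finset (Sg × Bool) := (S ×ˢ (Finset.univ : Finset Bool)).biUnion fun π' =>
    Finset.univ.filter fun π => node π = node π' with hB
  -- The `2|S|` ends of the matching have at most three ports each, of which `2|S|` in all belong to
  -- `S` itself. By maximality every other link uses one of the remaining `4|S|`, so there are at
  -- most `5|S|` links.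
  have hBcard : B.card ≤ 6 * S.card := by
    refine (Finset.card_biUnion_le_card_mul _ _ 3 fun π' _ => h.card_fiber_le _).trans ?_
    rw [Finset.card_product, Finset.card_univ, Fintype.card_bool]
    omega
  have hSB : S ×ˢ (Finset.univ : Finset Bool) ⊆ B := fun π hπ =>
    Finset.mem_biUnion.2 ⟨π, hπ, by simp⟩
  have hcover : (Finset.univ.filter fun s => IsLink node s) ⊆
      S ∪ (B \ S ×ˢ (Finset.univ : Finset Bool)).image Prod.fst := by
    intro s hs
    replace hs : IsLink node s := by simpa using hs
    by_cases hsS : s ∈ S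
    · exact Finset.mem_union_left _ hsS
    refine Finset.mem_union_right _ ?_
    -- A link that meets no matched vertex could be added to `S`, contrary to maximality.
    by_contra hno
    have hfree : ∀ (c : Bool) (π' : Sg × Bool), π'.1 ∈ S → node (s, c) ≠ node π' := by
      intro c π' hπ' hn
      refine hno (Finset.mem_image.2 ⟨(s, c), Finset.mem_sdiff.2 ⟨?_, ?_⟩, rfl⟩)
      · exact Finset.mem_biUnion.2 ⟨π', by simpa using hπ', by simpa using hn⟩
      · simpa using hsS
    have hins : IsDirectMatching node (insert s S) := by
      refine ⟨fun s' hs' c => ?_, ?_⟩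
      · rcases Finset.mem_insert.1 hs' with rfl | hs'
        · exact hs.1 c
        · exact hS.vertex s' hs' c
      · rintro ⟨a, c⟩ ⟨a', c'⟩ ha ha' hn
        simp only [Finset.mem_insert] at ha ha'
        rcases ha with rfl | ha <;> rcases ha' with rfl | ha'
        · cases c <;> cases c'
          · rfl
          · exact absurd hn hs.2
          · exact absurd hn.symm hs.2
          · rfl
        · exact absurd hn (hfree c _ ha')
        · exact absurd hn.symm (hfree c' _ ha)
        · exact hS.injective _ _ ha ha' hn
    have := hmax (insert s S) (by simpa using hins)
    rw [Finset.card_insert_of_notMem hsS] at this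
    omega
  have h1 := (Finset.card_le_card hcover).trans ((Finset.card_union_le _ _).trans
    (Nat.add_le_add_left Finset.card_image_le _))
  rw [Finset.card_sdiff_of_subset hSB, Finset.card_product, Finset.card_univ,
    Fintype.card_bool] at h1
  have h2 := h.card_vertices_le
  omega

end Matching

/-! ### The circuit of a schedule -/

namespace PortSchedule

variable {V M Sg : Type} {node : Sg × Bool → V ⊕ M} {S : Finset Sg}

theorem node_ne_of_mem {V M Sg : Type} {node : Sg × Bool → V ⊕ M} {S : Finset Sg}
    (T : PortSchedule node S) {s : Sg} (hs : s ∈ S) :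
    node (s, false) ≠ node (s, true) := fun h =>
  T.layer_ne _ _ h (by simp) ((T.layer_direct s hs _).trans (T.layer_direct s hs _).symm)

/-- The ports that carry a CNOT gate of their own. -/
abbrev ControlPort (S : Finset Sg) : Type := {π : Sg × Bool // π.1 ∉ S ∨ π.2 = false}

open Classical in
/-- The control port whose gate serves a port. -/
noncomputable def controlPort (S : Finset Sg) (π : Sg × Bool) : ControlPort S :=
  if h : π.1 ∉ S ∨ π.2 = false then ⟨π, h⟩ else ⟨(π.1, false), Or.inr rfl⟩

theorem controlPort_of {π : Sg × Bool} (h : π.1 ∉ S ∨ π.2 = false) :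
    controlPort S π = ⟨π, h⟩ := dif_pos h

theorem controlPort_direct {s : Sg} (h : s ∈ S) :
    controlPort S (s, true) = ⟨(s, false), Or.inr rfl⟩ := dif_neg (by simp [h])

theorem layer_controlPort (T : PortSchedule node S) (π : Sg × Bool) :
    T.layer (controlPort S π).1 = T.layer π := by
  by_cases h : π.1 ∉ S ∨ π.2 = false
  · rw [controlPort_of h]
  · obtain ⟨s, c⟩ := π
    have hs : s ∈ S := by by_contra hs; exact h (Or.inl hs)
    have hc : c = true := by cases c <;> simp_all
    rw [hc, controlPort_direct hs, T.layer_direct s hs, T.layer_direct s hs]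

variable [Fintype Sg] {n : ℕ}

noncomputable instance (S : Finset Sg) : Fintype (ControlPort S) := Fintype.ofFinite _

/-- The control ports in the order of their layers. -/
noncomputable def order (T : PortSchedule node S) :
    Fin (Fintype.card (ControlPort S)) ≃ ControlPort S :=
  (Tuple.sort fun i => T.layer ((Fintype.equivFin (ControlPort S)).symm i).1).trans
    (Fintype.equivFin (ControlPort S)).symm

theorem monotone_layer_order (T : PortSchedule node S) :
    Monotone fun i => T.layer (T.order i).1 :=
  Tuple.monotone_sort fun i => T.layer ((Fintype.equivFin (ControlPort S)).symm i).1

theorem card_controlPort (S : Finset Sg) :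
    Fintype.card (ControlPort S) + S.card = 2 * Fintype.card Sg := by
  classical
  rw [Fintype.card_of_subtype (Finset.univ.filter fun π : Sg × Bool => π.1 ∉ S ∨ π.2 = false)
    (by simp)]
  have h1 : (Finset.univ.filter fun π : Sg × Bool => π.1 ∉ S ∨ π.2 = false) =
      Finset.univ \ (S ×ˢ {true}) := by
    ext ⟨s, c⟩
    by_cases hs : s ∈ S <;> cases c <;> simp [hs]
  rw [h1, Finset.card_sdiff_of_subset (Finset.subset_univ _), Finset.card_univ,
    Fintype.card_prod, Fintype.card_bool, Finset.card_product, Finset.card_singleton]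
  have := Finset.card_le_univ S
  omega

open Classical in
/-- The numbering of the ancillae: vertices and segments that are not direct. -/
noncomputable def ancilla (V : Type) [Fintype V] (S : Finset Sg) :
    V ⊕ {s // s ∉ S} ≃ Fin (Fintype.card (V ⊕ {s // s ∉ S})) :=
  Fintype.equivFin _

open Classical in
theorem card_ancilla (V : Type) [Fintype V] (S : Finset Sg) :
    Fintype.card (V ⊕ {s // s ∉ S}) + S.card = Fintype.card V + Fintype.card Sg := by
  rw [Fintype.card_sum, Fintype.card_subtype_compl, Fintype.card_coe]
  have := Finset.card_le_univ S
  omega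

open Classical in
/-- The qubit of a node in the circuit of a schedule. -/
noncomputable def nodeLine [Fintype V] (S : Finset Sg) (mark : M ≃ Fin n) :
    V ⊕ M → Fin n ⊕ Fin (Fintype.card (V ⊕ {s // s ∉ S})) :=
  Sum.elim (fun v => Sum.inr (ancilla V S (Sum.inl v))) fun m => Sum.inl (mark m)

open Classical in
/-- The target of the gate of a control port. -/
noncomputable def targetLine [Fintype V] (node : Sg × Bool → V ⊕ M) (mark : M ≃ Fin n) (s : Sg) :
    Fin n ⊕ Fin (Fintype.card (V ⊕ {s // s ∉ S})) :=
  if h : s ∈ S then nodeLine S mark (node (s, true)) else Sum.inr (ancilla V S (Sum.inr ⟨s, h⟩))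

variable [Fintype V]

theorem nodeLine_injective (S : Finset Sg) (mark : M ≃ Fin n) :
    Function.Injective (nodeLine (V := V) S mark) := by
  rintro (v | m) (v' | m') h <;> simp [nodeLine] at h
  · rw [h]
  · rw [h]

theorem nodeLine_ne_ancilla (mark : M ≃ Fin n) (u : V ⊕ M) (s : {s // s ∉ S}) :
    nodeLine S mark u ≠ Sum.inr (ancilla V S (Sum.inr s)) := by
  rcases u with v | m <;> simp [nodeLine]

theorem nodeLine_ne_targetLine (T : PortSchedule node S) (mark : M ≃ Fin n) (γ : ControlPort S) :
    nodeLine S mark (node γ.1) ≠ targetLine node mark γ.1.1 := by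
  obtain ⟨⟨s, c⟩, hπ⟩ := γ
  rw [targetLine]
  split_ifs with hs
  · obtain rfl : c = false := hπ.resolve_left fun h => h hs
    exact fun h => T.node_ne_of_mem hs (nodeLine_injective S mark h)
  · exact nodeLine_ne_ancilla mark _ _

open Classical in
/-- The circuit of a schedule. -/
noncomputable def circuit (T : PortSchedule node S) (mark : M ≃ Fin n) : CNOTCircuit n where
  numAncillae := Fintype.card (V ⊕ {s // s ∉ S})
  prep q := if (∃ s : {s // s ∉ S}, q = Sum.inr (ancilla V S (Sum.inr s))) ∨
    ∃ s ∈ S, q = nodeLine S mark (node (s, true)) then .Z else .X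
  gates := List.ofFn fun i =>
    (nodeLine S mark (node (T.order i).1), targetLine node mark (T.order i).1.1)
  control_ne_target g hg := by
    obtain ⟨i, rfl⟩ := (List.mem_ofFn' _ _).1 hg
    exact T.nodeLine_ne_targetLine mark (T.order i)
  meas j := if ∃ s, j = ancilla V S (Sum.inr s) then .Z else .X

theorem length_gates (T : PortSchedule node S) (mark : M ≃ Fin n) :
    (T.circuit mark).gates.length = Fintype.card (ControlPort S) := List.length_ofFn

/-- The index of the gate that serves a port. -/
noncomputable def gateIdx (T : PortSchedule node S) (mark : M ≃ Fin n) (π : Sg × Bool) :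
    (T.circuit mark).GateIdx :=
  Fin.cast (T.length_gates mark).symm (T.order.symm (controlPort S π))

theorem gateQubit_gateIdx (T : PortSchedule node S) (mark : M ≃ Fin n) (π : Sg × Bool) (c : Bool) :
    (T.circuit mark).gateQubit (T.gateIdx mark π, c) =
      if c then targetLine node mark (controlPort S π).1.1
      else nodeLine S mark (node (controlPort S π).1) := by
  have h : (T.circuit mark).gates.get (T.gateIdx mark π) =
      (nodeLine S mark (node (controlPort S π).1),
        targetLine node mark (controlPort S π).1.1) := by
    refine (List.get_ofFn _ _).trans ?_
    have : Fin.cast (List.length_ofFn) (T.gateIdx mark π) = T.order.symm (controlPort S π) := rfl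
    rw [this, Equiv.apply_symm_apply]
  rw [CNOTCircuit.gateQubit, h]
  rfl

theorem gateIdx_lt (T : PortSchedule node S) (mark : M ≃ Fin n) {π π' : Sg × Bool}
    (h : T.layer π < T.layer π') : T.gateIdx mark π < T.gateIdx mark π' := by
  refine lt_of_not_ge fun hle => ?_
  have := T.monotone_layer_order
    (show T.order.symm (controlPort S π') ≤ T.order.symm (controlPort S π) from hle)
  simp only [Equiv.apply_symm_apply, layer_controlPort] at this
  exact absurd h (not_lt.2 this)

theorem gateIdx_eq_iff (T : PortSchedule node S) (mark : M ≃ Fin n) {π π' : Sg × Bool} :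
    T.gateIdx mark π = T.gateIdx mark π' ↔ controlPort S π = controlPort S π' := by
  rw [gateIdx, gateIdx, (Fin.cast_injective _).eq_iff, T.order.symm.injective.eq_iff]

open Classical in
/-- The circuit of a schedule realizes it. -/
noncomputable def realizes (T : PortSchedule node S) (mark : M ≃ Fin n) :
    (T.circuit mark).Realizes T where
  mark := mark
  vert v := ancilla V S (Sum.inl v)
  seg s := ancilla V S (Sum.inr s)
  vert_injective v v' h := Sum.inl_injective ((ancilla V S).injective h)
  seg_injective v v' h := Sum.inr_injective ((ancilla V S).injective h)
  vert_ne_seg v s h := Sum.inl_ne_inr ((ancilla V S).injective h)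
  vert_or_seg j := by
    obtain ⟨v | s, rfl⟩ := (ancilla V S).surjective j
    · exact Or.inl ⟨v, rfl⟩
    · exact Or.inr ⟨s, rfl⟩
  gate := T.gateIdx mark
  gate_surjective k := by
    refine ⟨(T.order (Fin.cast (T.length_gates mark) k)).1, ?_⟩
    rw [gateIdx, controlPort_of (T.order (Fin.cast (T.length_gates mark) k)).2,
      Subtype.coe_eta, Equiv.symm_apply_apply]
    rfl
  gate_inj π π' h := by
    rw [gateIdx_eq_iff] at h
    obtain ⟨s, c⟩ := π
    obtain ⟨s', c'⟩ := π'
    by_cases hs : s ∈ S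
    · refine Or.inr ⟨hs, ?_⟩
      have h1 : (controlPort S (s, c)).1.1 = s := by
        cases c
        · rw [controlPort_of (Or.inr rfl)]
        · rw [controlPort_direct hs]
      by_cases hs' : s' ∈ S
      · have h2 : (controlPort S (s', c')).1.1 = s' := by
          cases c'
          · rw [controlPort_of (Or.inr rfl)]
          · rw [controlPort_direct hs']
        exact h1.symm.trans ((congrArg (fun γ => γ.1.1) h).trans h2)
      · rw [controlPort_of (π := (s', c')) (Or.inl hs')] at h
        exact h1.symm.trans (congrArg (fun γ => γ.1.1) h)
    · rw [controlPort_of (π := (s, c)) (Or.inl hs)] at h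
      by_cases hs' : s' ∈ S
      · have h2 : (controlPort S (s', c')).1.1 = s' := by
          cases c'
          · rw [controlPort_of (Or.inr rfl)]
          · rw [controlPort_direct hs']
        rw [← h] at h2
        exact absurd ((show s = s' from h2) ▸ hs') hs
      · rw [controlPort_of (π := (s', c')) (Or.inl hs')] at h
        exact Or.inl (congrArg Subtype.val h)
  gate_direct s hs := by
    rw [gateIdx_eq_iff, controlPort_direct hs, controlPort_of (Or.inr rfl)]
  gate_lt π π' _ h := T.gateIdx_lt mark h
  control π hπ := by
    rw [gateQubit_gateIdx, controlPort_of hπ]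
    rfl
  target_seg s c := by
    rw [gateQubit_gateIdx, controlPort_of (Or.inl s.2), if_pos rfl, targetLine, dif_neg s.2]
    rfl
  target_direct s hs := by
    rw [gateQubit_gateIdx, controlPort_direct hs, if_pos rfl, targetLine, dif_pos hs]
    rfl
  prep_seg s := if_pos (Or.inl ⟨s, rfl⟩)
  meas_seg s := if_pos ⟨s, rfl⟩
  meas_vert v := if_neg fun ⟨s, hs⟩ => Sum.inl_ne_inr ((ancilla V S).injective hs)
  prep_node u := by
    constructor
    · intro h
      by_contra hno
      have hX : (T.circuit mark).prep (nodeLine S mark u) = .X := by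
        refine if_neg ?_
        rintro (⟨s, hs⟩ | ⟨s, hs, hu⟩)
        · exact nodeLine_ne_ancilla mark _ _ hs
        · exact hno ⟨s, hs, (nodeLine_injective S mark hu).symm⟩
      exact ZXType.noConfusion (h.symm.trans hX)
    · rintro ⟨s, hs, rfl⟩
      exact if_pos (Or.inr ⟨s, hs, rfl⟩)

end PortSchedule

/-! ### Depth -/

namespace CNOTCircuit

variable {n : ℕ} (C : CNOTCircuit n)

/-- The depth reached on a qubit by the first `i` gates. -/
def depthAt (i : ℕ) : C.Qubit → ℕ := depthOn (C.gates.take i)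

theorem depthAt_length : C.depthAt C.gates.length = depthOn C.gates := by
  rw [depthAt, List.take_length]

theorem depthAt_succ (i : C.GateIdx) (w : C.Qubit) : C.depthAt (i + 1) w =
    if w = C.gateQubit (i, false) ∨ w = C.gateQubit (i, true) then
      max (C.depthAt i (C.gateQubit (i, false))) (C.depthAt i (C.gateQubit (i, true))) + 1
    else C.depthAt i w := by
  rw [depthAt, depthOn, List.take_succ_eq_append_getElem i.2, List.foldl_append]
  rfl

theorem depthAt_le_succ (i : C.GateIdx) (w : C.Qubit) : C.depthAt i w ≤ C.depthAt (i + 1) w := by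
  rw [depthAt_succ]
  split_ifs with h
  · rcases h with rfl | rfl
    · exact (le_max_left _ _).trans (Nat.le_succ _)
    · exact (le_max_right _ _).trans (Nat.le_succ _)
  · exact le_rfl

theorem depthAt_mono {i j : ℕ} (hij : i ≤ j) (hj : j ≤ C.gates.length) (w : C.Qubit) :
    C.depthAt i w ≤ C.depthAt j w := by
  induction j, hij using Nat.le_induction with
  | base => exact le_rfl
  | succ j hij ih =>
    exact (ih (Nat.le_of_succ_le hj)).trans (C.depthAt_le_succ ⟨j, hj⟩ w)

theorem lt_depthAt_succ (i : C.GateIdx) (c c' : Bool) :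
    C.depthAt i (C.gateQubit (i, c)) < C.depthAt (i + 1) (C.gateQubit (i, c')) := by
  rw [depthAt_succ, if_pos (by cases c' <;> simp)]
  cases c
  · exact Nat.lt_succ_of_le (le_max_left _ _)
  · exact Nat.lt_succ_of_le (le_max_right _ _)

/-- If gates that share a qubit are in increasing layers, the depth is at most the number of layers. -/
theorem cnotDepth_le {L : ℕ} (lay : C.GateIdx → Fin L)
    (h : ∀ (i j : C.GateIdx) (c c' : Bool), i < j → C.gateQubit (i, c) = C.gateQubit (j, c') →
      lay i < lay j) : C.cnotDepth ≤ L := by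
  -- Invariant: the depth on a used qubit is bounded by the layer, counted from one, of some earlier
  -- gate on that qubit.
  have key : ∀ i, i ≤ C.gates.length → ∀ w, C.depthAt i w = 0 ∨
      ∃ (j : C.GateIdx) (c : Bool), (j : ℕ) < i ∧ C.gateQubit (j, c) = w ∧
        C.depthAt i w ≤ lay j + 1 := by
    intro i
    induction i with
    | zero => exact fun _ w => Or.inl rfl
    | succ i ih =>
      intro hi w
      have hle : ∀ c, C.depthAt i (C.gateQubit (⟨i, hi⟩, c)) ≤ lay ⟨i, hi⟩ := by
        intro c
        rcases ih (Nat.le_of_succ_le hi) (C.gateQubit (⟨i, hi⟩, c)) with h0 | ⟨j, d, hj, hw, hd⟩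
        · rw [h0]; exact Nat.zero_le _
        · exact hd.trans (Fin.lt_def.1 (h j ⟨i, hi⟩ d c (Fin.lt_def.2 hj) hw))
      have hs := C.depthAt_succ ⟨i, hi⟩ w
      simp only at hs
      by_cases hw : w = C.gateQubit (⟨i, hi⟩, false) ∨ w = C.gateQubit (⟨i, hi⟩, true)
      · rw [if_pos hw] at hs
        refine Or.inr ?_
        rw [hs]
        rcases hw with hw | hw
        · exact ⟨⟨i, hi⟩, false, Nat.lt_succ_self _, hw.symm,
            Nat.succ_le_succ (max_le (hle _) (hle _))⟩
        · exact ⟨⟨i, hi⟩, true, Nat.lt_succ_self _, hw.symm,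
            Nat.succ_le_succ (max_le (hle _) (hle _))⟩
      · rw [if_neg hw] at hs
        rw [hs]
        rcases ih (Nat.le_of_succ_le hi) w with h0 | ⟨j, d, hj, hjw, hd⟩
        · exact Or.inl h0
        · exact Or.inr ⟨j, d, hj.trans (Nat.lt_succ_self _), hjw, hd⟩
  refine Finset.sup_le fun w _ => ?_
  rw [← C.depthAt_length]
  rcases key _ le_rfl w with h0 | ⟨j, -, -, -, hd⟩
  · rw [h0]; exact Nat.zero_le _
  · exact hd.trans (lay j).2

/-- A gate raises the depth on both its qubits strictly above the earlier depth of either one, and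
depth never decreases, so a chain of three gates forces three steps. -/
theorem three_le_cnotDepth {i j k : C.GateIdx} {c₁ c₂ c₃ c₄ : Bool} (hij : i < j) (hjk : j < k)
    (h₁ : C.gateQubit (i, c₁) = C.gateQubit (j, c₂))
    (h₂ : C.gateQubit (j, c₃) = C.gateQubit (k, c₄)) : 3 ≤ C.cnotDepth := by
  have a₁ := C.lt_depthAt_succ i c₁ c₁
  have b₁ := C.depthAt_mono (Nat.succ_le_of_lt hij) j.2.le (C.gateQubit (i, c₁))
  rw [h₁] at a₁ b₁
  have a₂ := C.lt_depthAt_succ j c₂ c₃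
  have b₂ := C.depthAt_mono (Nat.succ_le_of_lt hjk) k.2.le (C.gateQubit (j, c₃))
  rw [h₂] at a₂ b₂
  have a₃ := C.lt_depthAt_succ k c₄ c₄
  have b₃ := C.depthAt_mono (Nat.succ_le_of_lt k.2) le_rfl (C.gateQubit (k, c₄))
  have hsup : depthOn C.gates (C.gateQubit (k, c₄)) ≤ C.cnotDepth :=
    Finset.le_sup (f := depthOn C.gates) (Finset.mem_univ _)
  rw [← C.depthAt_length] at hsup
  simp only [Nat.succ_eq_add_one] at b₁ b₂ b₃
  omega

end CNOTCircuit

namespace CNOTCircuit.Realizes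

variable {n : ℕ} {C : CNOTCircuit n} {V M Sg : Type} {node : Sg × Bool → V ⊕ M} {S : Finset Sg}
  {T : PortSchedule node S} (R : C.Realizes T)

theorem layer_eq_of_gate_eq {π π' : Sg × Bool} (h : R.gate π = R.gate π') :
    T.layer π = T.layer π' := by
  rcases R.gate_inj _ _ h with rfl | ⟨hs, hss⟩
  · rfl
  · exact (T.layer_direct π.1 hs π.2).trans (T.layer_direct π'.1 (hss ▸ hs) π'.2).symm

theorem qubit_cases (w : C.Qubit) : (∃ u, R.qubit u = w) ∨ ∃ s, Sum.inr (R.seg s) = w := by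
  rcases w with k | j
  · exact Or.inl ⟨Sum.inr (R.mark.symm k), by simp [qubit, nodeQubit]⟩
  · rcases R.vert_or_seg j with ⟨v, rfl⟩ | ⟨s, rfl⟩
    · exact Or.inl ⟨Sum.inl v, rfl⟩
    · exact Or.inr ⟨s, rfl⟩

theorem exists_gateQubit_eq (π : Sg × Bool) :
    ∃ c, C.gateQubit (R.gate π, c) = R.qubit (node π) := by
  by_cases h : π.1 ∉ S ∨ π.2 = false
  · exact ⟨false, R.control π h⟩
  · obtain ⟨s, c⟩ := π
    have hs : s ∈ S := by by_contra hs; exact h (Or.inl hs)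
    have hc : c = true := by cases c <;> simp_all
    exact ⟨true, by rw [hc]; exact R.target_direct s hs⟩

theorem cnotDepth_le_three
    (hR : ∀ π π', T.layer π < T.layer π' → R.gate π < R.gate π') : C.cnotDepth ≤ 3 := by
  choose port hport using R.gate_surjective
  refine C.cnotDepth_le (fun k => T.layer (port k)) fun i j c c' hij hw => ?_
  have hl : ∀ π, T.layer (port (R.gate π)) = T.layer π := fun π => R.layer_eq_of_gate_eq (hport _)
  rcases R.qubit_cases (C.gateQubit (j, c')) with ⟨u, hu⟩ | ⟨s, hs⟩
  · obtain ⟨π, hπ, rfl⟩ := R.exists_port (hw.trans hu.symm)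
    obtain ⟨π', hπ', rfl⟩ := R.exists_port hu.symm
    simp only [hl]
    exact R.layer_lt (hπ.trans hπ'.symm) hij
  · obtain ⟨d, rfl⟩ := R.exists_of_seg (hw.trans hs.symm)
    obtain ⟨d', rfl⟩ := R.exists_of_seg hs.symm
    simp only [hl]
    have hne : T.layer (s.1, d) ≠ T.layer (s.1, d') := by
      have := T.layer_seg_ne s.1 s.2
      cases d <;> cases d'
      · exact absurd hij (lt_irrefl _)
      · exact this
      · exact this.symm
      · exact absurd hij (lt_irrefl _)
    exact lt_of_le_of_ne (le_of_not_gt fun h => lt_asymm hij (hR _ _ h)) hne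

theorem three_le_cnotDepth_of_hasChain
    (hR : ∀ π π', T.layer π < T.layer π' → R.gate π < R.gate π') (hT : T.HasChain) : 3 ≤ C.cnotDepth := by
  obtain ⟨π₁, π₂, π₃, h₁, h₂, h₃, h₁₂, h₂₃⟩ := hT
  have lt₁ : R.gate π₁ < R.gate π₂ := hR _ _ (by rw [h₁, h₂]; decide)
  have lt₂ : R.gate π₂ < R.gate π₃ := hR _ _ (by rw [h₂, h₃]; decide)
  obtain ⟨c₂, hc₂⟩ := R.exists_gateQubit_eq π₂
  obtain ⟨c₃, hc₃⟩ := R.exists_gateQubit_eq π₃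
  have e₂ : C.gateQubit (R.gate π₂, c₂) = C.gateQubit (R.gate π₃, c₃) := by
    rw [hc₂, hc₃, h₂₃]
  obtain ⟨c, c', hcc⟩ : ∃ c c', C.gateQubit (R.gate π₁, c) = C.gateQubit (R.gate π₂, c') := by
    rcases h₁₂ with h | ⟨hs, h⟩
    · obtain ⟨c₁, hc₁⟩ := R.exists_gateQubit_eq π₁
      exact ⟨c₁, c₂, by rw [hc₁, hc₂, h]⟩
    · refine ⟨true, true, (R.target_seg ⟨π₁.1, hs⟩ π₁.2).trans ?_⟩
      have := R.target_seg ⟨π₁.1, hs⟩ π₂.2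
      simp only [h] at this ⊢
      exact this.symm
  exact C.three_le_cnotDepth lt₁ lt₂ hcc e₂

end CNOTCircuit.Realizes

/-! ### The ports of a marked graph -/

namespace MarkedGraph

variable (G : MarkedGraph)

theorem segStart_edge_eq_vertex {e : Fin G.numEdges} {i : Fin (G.edgeMarks e + 1)}
    {v : Fin G.numVertices} :
    G.segStart (Sum.inl ⟨e, i⟩) = Sum.inl v ↔ i = 0 ∧ G.src e = v := by
  cases i using Fin.cases <;> simp [segStart]

theorem segEnd_edge_eq_vertex {e : Fin G.numEdges} {i : Fin (G.edgeMarks e + 1)}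
    {v : Fin G.numVertices} :
    G.segEnd (Sum.inl ⟨e, i⟩) = Sum.inl v ↔ i = Fin.last _ ∧ G.tgt e = v := by
  cases i using Fin.lastCases <;> simp [segEnd, Fin.castSucc_ne_last]

theorem segStart_edge_eq_mark {e e' : Fin G.numEdges} {i : Fin (G.edgeMarks e + 1)}
    {j : Fin (G.edgeMarks e')} :
    G.segStart (Sum.inl ⟨e, i⟩) = Sum.inr (Sum.inl ⟨e', j⟩) ↔
      (⟨e, i⟩ : Σ e, Fin (G.edgeMarks e + 1)) = ⟨e', j.succ⟩ := by
  constructor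
  · intro h
    cases i using Fin.cases with
    | zero => simp [segStart] at h
    | succ i =>
      simp only [segStart, Fin.cases_succ, Sum.inr.injEq, Sum.inl.injEq] at h
      cases h
      rfl
  · intro h
    cases h
    simp [segStart]

theorem segEnd_edge_eq_mark {e e' : Fin G.numEdges} {i : Fin (G.edgeMarks e + 1)}
    {j : Fin (G.edgeMarks e')} :
    G.segEnd (Sum.inl ⟨e, i⟩) = Sum.inr (Sum.inl ⟨e', j⟩) ↔
      (⟨e, i⟩ : Σ e, Fin (G.edgeMarks e + 1)) = ⟨e', j.castSucc⟩ := by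
  constructor
  · intro h
    cases i using Fin.lastCases with
    | last => simp [segEnd] at h
    | cast i =>
      simp only [segEnd, Fin.lastCases_castSucc, Sum.inr.injEq, Sum.inl.injEq] at h
      cases h
      rfl
  · intro h
    cases h
    simp [segEnd]

theorem card_ports_vertex (v : Fin G.numVertices) :
    (Finset.univ.filter fun π => G.portNode π = Sum.inl v).card = 3 := by
  classical
  have h : (Finset.univ.filter fun π => G.portNode π = Sum.inl v) =
      (Finset.univ.filter fun e => G.src e = v).image
        (fun e => ((Sum.inl ⟨e, 0⟩ : G.Segment), false)) ∪
      (Finset.univ.filter fun e => G.tgt e = v).image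
        (fun e => ((Sum.inl ⟨e, Fin.last _⟩ : G.Segment), true)) := by
    ext ⟨s, c⟩
    simp only [Finset.mem_filter, Finset.mem_univ, true_and, Finset.mem_union, Finset.mem_image,
      Prod.mk.injEq]
    rcases s with ⟨e, i⟩ | ⟨k, i⟩
    · cases c
      · rw [portNode, if_neg (by simp), segStart_edge_eq_vertex]
        constructor
        · rintro ⟨rfl, h⟩
          exact Or.inl ⟨e, h, rfl, rfl⟩
        · rintro (⟨e', h, he, -⟩ | ⟨e', h, he, hf⟩)
          · cases he
            exact ⟨rfl, h⟩
          · simp at hf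
      · rw [portNode, if_pos rfl, segEnd_edge_eq_vertex]
        constructor
        · rintro ⟨rfl, h⟩
          exact Or.inr ⟨e, h, rfl, rfl⟩
        · rintro (⟨e', h, he, hf⟩ | ⟨e', h, he, -⟩)
          · simp at hf
          · cases he
            exact ⟨rfl, h⟩
    · cases c <;> simp [portNode, segStart, segEnd]
  rw [h, Finset.card_union_of_disjoint, Finset.card_image_of_injective,
    Finset.card_image_of_injective, G.regular v]
  · intro e e' h
    simp only [Prod.mk.injEq, Sum.inl.injEq, Sigma.mk.injEq] at h
    exact h.1.1
  · intro e e' h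
    simp only [Prod.mk.injEq, Sum.inl.injEq, Sigma.mk.injEq] at h
    exact h.1.1
  · rw [Finset.disjoint_left]
    intro π hπ hπ'
    obtain ⟨e, -, rfl⟩ := Finset.mem_image.1 hπ
    obtain ⟨e', -, h⟩ := Finset.mem_image.1 hπ'
    simp at h

theorem card_ports_mark (m : G.Mark) :
    (Finset.univ.filter fun π => G.portNode π = Sum.inr m).card = 2 := by
  classical
  rw [Finset.card_eq_two]
  rcases m with ⟨e, j⟩ | ⟨k, j⟩
  · refine ⟨(Sum.inl ⟨e, j.succ⟩, false), (Sum.inl ⟨e, j.castSucc⟩, true), by simp, ?_⟩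
    ext ⟨s, c⟩
    simp only [Finset.mem_filter, Finset.mem_univ, true_and, Finset.mem_insert,
      Finset.mem_singleton, Prod.mk.injEq]
    rcases s with ⟨e', i⟩ | ⟨k, i⟩
    · cases c
      · rw [portNode, if_neg (by simp), segStart_edge_eq_mark]
        simp
      · rw [portNode, if_pos rfl, segEnd_edge_eq_mark]
        simp
    · cases c <;> simp [portNode, segStart, segEnd]
  -- The segment that ends at mark `j` of a closed loop starts at its cyclic predecessor. With a
  -- single mark both ports belong to the same segment but remain distinct.
  · refine ⟨(Sum.inr ⟨k, j⟩, false), (Sum.inr ⟨k, (finRotate _).symm j⟩, true), by simp, ?_⟩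
    ext ⟨s, c⟩
    simp only [Finset.mem_filter, Finset.mem_univ, true_and, Finset.mem_insert,
      Finset.mem_singleton, Prod.mk.injEq]
    rcases s with ⟨e', i⟩ | ⟨k', i⟩
    · cases c
      · rw [portNode, if_neg (by simp)]
        cases i using Fin.cases <;> simp [segStart]
      · rw [portNode, if_pos rfl]
        cases i using Fin.lastCases <;> simp [segEnd]
    · cases c
      · simp [portNode, segStart]
      · simp only [portNode, segEnd, if_true, Sum.inr.injEq, Sigma.mk.injEq, and_true,
          Bool.true_eq_false, and_false, false_or]
        constructor
        · rintro ⟨rfl, h⟩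
          exact ⟨rfl, heq_of_eq ((Equiv.symm_apply_eq _).2 (eq_of_heq h).symm).symm⟩
        · rintro ⟨rfl, h⟩
          exact ⟨rfl, heq_of_eq (by rw [eq_of_heq h, Equiv.apply_symm_apply])⟩

theorem isCubic : IsCubic G.portNode := ⟨G.card_ports_vertex, G.card_ports_mark⟩

theorem card_mark : Fintype.card G.Mark = G.numMarks := by
  simp [Mark, numMarks, Fintype.card_sum, Fintype.card_sigma]

variable {G}

/-- Otherwise a single mark could be separated from the others by a cut of size zero with marks on
both sides. -/
theorem IsRobust.exists_ne_of_isEmpty {t : ℕ} (hG : G.IsRobust t) (hn : 2 ≤ G.numMarks) :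
    ∃ s, G.portNode (s, false) ≠ G.portNode (s, true) := by
  classical
  by_contra! hloop
  have hcard := hn
  rw [← G.card_mark] at hcard
  obtain ⟨m, m', hne⟩ := Fintype.one_lt_card_iff.1 hcard
  have hcut : G.cutSize {Sum.inr m} = 0 := by
    refine Finset.card_eq_zero.2 (Finset.filter_false_of_mem fun s _ h => h ?_)
    have : G.segStart s = G.segEnd s := hloop s
    rw [this]
  have h := hG {Sum.inr m} (hcut ▸ Nat.zero_le t)
  rw [hcut] at h
  rcases h with h | h
  · refine absurd (Finset.card_eq_zero.1 (Nat.le_zero.1 h)) (Finset.Nonempty.ne_empty ⟨m, ?_⟩)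
    simp
  · refine absurd (Finset.card_eq_zero.1 (Nat.le_zero.1 h)) (Finset.Nonempty.ne_empty ⟨m', ?_⟩)
    simpa using hne.symm

theorem IsRobust.exists_schedule {t : ℕ} (hG : G.IsRobust t) :
    ∃ (S : Finset G.Segment) (T : PortSchedule G.portNode S),
      G.numVertices ≤ 10 * S.card + 2 * G.numMarks ∧ (2 ≤ G.numMarks → T.HasChain) := by
  classical
  by_cases hv : 0 < G.numVertices
  · obtain ⟨S, hS, hcard⟩ := G.isCubic.exists_directMatching
    rw [G.card_mark, Fintype.card_fin] at hcard
    obtain ⟨T⟩ := G.isCubic.exists_schedule hS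
    exact ⟨S, T, hcard, fun _ => T.hasChain_of_vertex ⟨0, hv⟩⟩
  · have h0 : G.numVertices = 0 := Nat.eq_zero_of_not_pos hv
    have : IsEmpty (Fin G.numVertices) := by rw [h0]; infer_instance
    by_cases hn : 2 ≤ G.numMarks
    · obtain ⟨s, hs⟩ := hG.exists_ne_of_isEmpty hn
      obtain ⟨T, hT⟩ := G.isCubic.exists_schedule_of_isEmpty hs
      exact ⟨∅, T, by omega, fun _ => hT⟩
    · obtain ⟨T⟩ := G.isCubic.exists_schedule isDirectMatching_empty
      exact ⟨∅, T, by omega, fun h => absurd h hn⟩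

end MarkedGraph

/-! ### Resource bounds and conclusion -/

theorem cast_le_ratio_mul {r : ℝ≥0∞} {v n a b c d : ℕ} (hr : r * n = v) (hd : d ≠ 0)
    (h : d * c ≤ a * v + b * n) : (c : ℝ≥0∞) ≤ (a * r + b) / d * n := by
  have h1 : ((a : ℝ≥0∞) * r + b) / d * n = (a * v + b * n) / d := by
    rw [← hr, div_eq_mul_inv, div_eq_mul_inv]; ring
  rw [h1, ENNReal.le_div_iff_mul_le (Or.inl (by exact_mod_cast hd))
    (Or.inl (ENNReal.natCast_ne_top d))]
  rw [mul_comm] at h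
  exact_mod_cast h

theorem mainTheorem8 (t : ℕ) (G : MarkedGraph) (hn : 0 < G.numMarks) (hG : G.IsRobust t)
    (hr : G.vertexRatio = optimalVertexRatio t) :
    ∃ C : CNOTCircuit G.numMarks,
      ZXDiagram.FTPreparesCat t C.associatedDiagram ∧
      (C.cnotCount : ℝ≥0∞) ≤ (29 * optimalVertexRatio t + 26) / 10 * G.numMarks ∧
      C.cnotDepth ≤ 3 ∧ (2 ≤ G.numMarks → C.cnotDepth = 3) ∧
      (C.numAncillae : ℝ≥0∞) ≤ (12 * optimalVertexRatio t + 8) / 5 * G.numMarks := by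
  obtain ⟨S, T, hS, hchain⟩ := hG.exists_schedule
  let mark : G.Mark ≃ Fin G.numMarks := Fintype.equivFinOfCardEq G.card_mark
  let R := T.realizes mark
  have hR : ∀ π π', T.layer π < T.layer π' → R.gate π < R.gate π' := fun π π' h =>
    T.gateIdx_lt mark h
  have hdepth := R.cnotDepth_le_three hR
  have hrn : optimalVertexRatio t * (G.numMarks : ℝ≥0∞) = (G.numVertices : ℝ≥0∞) := by
    rw [← hr, MarkedGraph.vertexRatio]
    exact ENNReal.div_mul_cancel (by exact_mod_cast hn.ne') (ENNReal.natCast_ne_top _)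
  have hseg := G.isCubic.two_mul_card_segments
  rw [Fintype.card_fin, G.card_mark] at hseg
  have hcnot : (T.circuit mark).cnotCount + S.card = 2 * Fintype.card G.Segment := by
    rw [← PortSchedule.card_controlPort, ← T.length_gates mark]; rfl
  have hanc : (T.circuit mark).numAncillae + S.card =
      G.numVertices + Fintype.card G.Segment := by
    have := PortSchedule.card_ancilla (Fin G.numVertices) S
    rwa [Fintype.card_fin] at this
  refine ⟨T.circuit mark, hG.ftPreparesCat hn R, ?_, hdepth, fun h2 =>
    le_antisymm hdepth (R.three_le_cnotDepth_of_hasChain hR (hchain h2)), ?_⟩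
  -- From `10|S| ≥ v - 2n`, ten times the CNOT count `3v + 2n - |S|` is at most `29v + 22n`, and
  -- five times the ancilla count `5v/2 + n - |S|` is at most `12v + 6n`; the stated constants `26`
  -- and `8` leave some slack.
  · exact_mod_cast cast_le_ratio_mul (a := 29) (b := 26) (d := 10) hrn (by norm_num) (by omega)
  · exact_mod_cast cast_le_ratio_mul (a := 12) (b := 8) (d := 5) hrn (by norm_num) (by omega)
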